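/- Let $U$ be an index set and let $\mathbb{R}^U$ carry its cylindrical $\sigma$-algebra. For a finite set $\hat u\subset U$ let $\pi_{\hat u}:\mathbb{R}^U\to\mathbb{R}^{\hat u}$ be the projection, and for $\hat u\subset\hat v$ let $\pi_{\hat v\hat u}:\mathbb{R}^{\hat v}\to\mathbb{R}^{\hat u}$ be the projection. Characteristic triplets on $\mathbb{R}^{\hat u}$ are taken with respect to the truncation function $\tau(x)=(x_i/(1\vee|x_i|))_i$, and Lévy measures have no mass at the origin. A measure $\nu$ on $\mathbb{R}^U$ *does not charge zero* if $\nu\{x: x_u=0\ \forall u\in U_0\}=0$ for some countable $U_0\subset U$. Given a system of triplets $(\gamma_{\hat u},B_{\hat u},\nu_{\hat u})$ indexed by the finite sets $\hat u\subset U$, a measure $\nu$ is a *pseudo master Lévy measure* of the system if $\int 1\wedge|x_u|^2\,\nu(dx)<\infty$ for all $u\in U$ and $\nu_{\hat u}(A)=\nu(\pi_{\hat u}^{-1}(A))$ for all $\hat u$ and all Borel $A\subset\mathbb{R}^{\hat u}\setminus\{0\}$; it is a *master Lévy measure* if moreover it does not charge zero. The system is *consistent* if there are unique functions $\Gamma:U\to\mathbb{R}$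 and $B:U\times U\to\mathbb{R}$ with $\gamma_{\hat u}=\pi_{\hat u}(\Gamma)$ and $B_{\hat u}=(B(u,v))_{u,v\in\hat u}$ for all $\hat u$, and $\nu_{\hat u}=\nu_{\hat v}\circ\pi_{\hat v\hat u}^{-1}$ on Borel subsets of $\mathbb{R}^{\hat u}\setminus\{0\}$ whenever $\hat u\subset\hat v$. Let $X=(X_u)_{u\in U}$ be a real infinitely divisible (ID) field with characteristic triplet $(\Gamma,B,\nu)$: $\nu$ is a measure on $\mathbb{R}^U$ that does not charge zero, $\int 1\wedge|x_u|^2\,\nu(dx)<\infty$ for every $u\in U$, and for each finite $\hat u$ the law of $X_{\hat u}$ has characteristic triplet $(\Gamma_{\hat u},B_{\hat u},\nu_{\hat u})$ with $\Gamma_{\hat u}=\pi_{\hat u}(\Gamma)$, $B_{\hat u}=(B(u,v))_{u,v\in\hat u}$ and $\nu_{\hat u}=\nu\circ\pi_{\hat u}^{-1}$ on $\mathbb{R}^{\hat u}\setminus\{0\}$. Let $f:\mathbb{R}\to\mathbb{R}$ be measurable and suppose that for every finite $\hat u\subset U$ $$\int_{\mathbb{R}}\Big|f(s)\Gamma_{\hat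 u}+\int(\tau(f(s)x)-f(s)\tau(x))\,\nu_{\hat u}(dx)\Big|ds<\infty,\qquad \int_{\mathbb{R}}f(s)^2|B_{\hat u}|\,ds<\infty,\qquad \int_{\mathbb{R}}\int 1\wedge|f(s)x|^2\,\nu_{\hat u}(dx)\,ds<\infty .$$ Define $$\Gamma^I_{\hat u}=\int_{\mathbb{R}}\Big[f(s)\Gamma_{\hat u}+\int(\tau(f(s)x)-f(s)\tau(x))\,\nu_{\hat u}(dx)\Big]ds,\qquad B^I_{\hat u}=\int_{\mathbb{R}}f(s)^2B_{\hat u}\,ds,$$ $$\nu^I_{\hat u}(A)=\int_{\mathbb{R}}\int \mathbf 1_A(f(s)x)\,\nu_{\hat u}(dx)\,ds\quad\text{for Borel }A\subset\mathbb{R}^{\hat u}\setminus\{0\},\qquad \nu^I_{\hat u}(\{0\})=0.$$ Then: 1. For every finite $\hat u$, if $L_{\hat u}$ is a two-sided Lévy process (in law) in $\mathbb{R}^{\hat u}$ with $L_{\hat u}(1)\overset{d}{=}X_{\hat u}$, then every stochastic integral $\int_{\mathbb{R}}f\,dL_{\hat u}$ (a limit in probability of elementary integrals of step functions converging to $f$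 almost everywhere and in the Musielak–Orlicz modular $r\mapsto |r\Gamma_{\hat u}+\int(\tau(rx)-r\tau(x))\nu_{\hat u}(dx)|+r^2\operatorname{tr}B_{\hat u}+\int 1\wedge|rx|^2\,\nu_{\hat u}(dx)$) is ID with characteristic triplet $(\Gamma^I_{\hat u},B^I_{\hat u},\nu^I_{\hat u})$. 2. The system $(\Gamma^I_{\hat u},B^I_{\hat u},\nu^I_{\hat u})_{\hat u}$ is a consistent system of characteristic triplets. 3. There is an ID field $I(f\ddagger X)$ over $U$, unique in law, whose finite-dimensional triplets are $(\Gamma^I_{\hat u},B^I_{\hat u},\nu^I_{\hat u})$. It has a unique master Lévy measure, namely $$\nu^{I}(A)=\int_{\{s:\,f(s)\neq0\}}\int_{\mathbb{R}^U}\mathbf 1_A(f(s)x)\,\nu(dx)\,ds,\qquad A\subset\mathbb{R}^U\text{ measurable},$$ and it has a characteristic triplet $(\Gamma^I,B^I,\nu^I)$ for some functions $\Gamma^I:U\to\mathbb{R}$ and $B^I:U\times U\to\mathbb{R}$. The measure $A\mapsto\int_{\mathbb{R}}\int_{\mathbb{R}^U}\mathbf 1_A(f(s)x)\,\nu(dx)\,ds$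 is a pseudo master Lévy measure of $I(f\ddagger X)$, and it is the master Lévy measure if $f\neq0$ almost everywhere. -/

import Mathlib

open MeasureTheory ProbabilityTheory Filter Topology
open scoped ENNReal

noncomputable section

/-- The one-dimensional truncation `x ↦ x / (1 ∨ |x|)`. -/
def trunc (r : ℝ) : ℝ := r / max 1 |r|

/-- The coordinatewise truncation function on `ℝ^ι`. -/
def truncVec {ι : Type*} (x : ι → ℝ) : ι → ℝ := fun i => trunc (x i)

/-- `1 ∧ |x|²`, with the Euclidean norm, as an extended nonnegative real. -/
def capSq {ι : Type*} [Fintype ι] (x : ι → ℝ) : ℝ≥0∞ :=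
  ENNReal.ofReal (min 1 (∑ i, x i ^ 2))

/-- Lévy measures on `ℝ^ι`: no mass at the origin, and `∫ 1 ∧ |x|² dν < ∞`. -/
structure IsLevyMeasure {ι : Type*} [Fintype ι] (ν : Measure (ι → ℝ)) : Prop where
  zero_null : ν {0} = 0
  capSq_lt_top : ∫⁻ x, capSq x ∂ν < ∞

/-- The data `(γ, B, ν)` of a characteristic triplet on `ℝ^ι`. -/
structure CharTriplet (ι : Type*) where
  drift : ι → ℝ
  cov : Matrix ι ι ℝ
  levy : Measure (ι → ℝ)

namespace CharTriplet

variable {ι : Type*} [Fintype ι]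

/-- The data form a genuine characteristic triplet: `B` is symmetric and non-negative definite
and `ν` is a Lévy measure. -/
structure IsValid (T : CharTriplet ι) : Prop where
  cov_posSemidef : T.cov.PosSemidef
  isLevyMeasure : IsLevyMeasure T.levy

/-- The Lévy–Khintchine exponent (cumulant function) of a triplet. -/
def exponent (T : CharTriplet ι) (θ : ι → ℝ) : ℂ :=
  Complex.I * ((∑ i, θ i * T.drift i : ℝ) : ℂ)
    - ((1 / 2 * ∑ i, ∑ j, θ i * T.cov i j * θ j : ℝ) : ℂ)
    + ∫ x, (Complex.exp (Complex.I * ((∑ i, θ i * x i : ℝ) : ℂ)) - 1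
        - Complex.I * ((∑ i, θ i * truncVec x i : ℝ) : ℂ)) ∂T.levy

/-- `r γ + ∫ (τ(r x) - r τ(x)) ν(dx)`. -/
def scaledDrift (T : CharTriplet ι) (r : ℝ) : ι → ℝ :=
  r • T.drift + ∫ x, (truncVec (r • x) - r • truncVec x) ∂T.levy

/-- The Musielak–Orlicz modular
`|r γ + ∫ (τ(r x) - r τ(x)) ν(dx)| + r² tr B + ∫ 1 ∧ |r x|² ν(dx)` of a triplet. -/
def modular (T : CharTriplet ι) (r : ℝ) : ℝ≥0∞ :=
  ‖T.scaledDrift r‖ₑ + ENNReal.ofReal (r ^ 2 * T.cov.trace) + ∫⁻ x, capSq (r • x) ∂T.levy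

/-- The integrability conditions on `f` with respect to a two-sided Lévy process whose value at
time one has the triplet `T`. -/
structure IntegrableFor (T : CharTriplet ι) (f : ℝ → ℝ) : Prop where
  measurable : Measurable f
  drift : Integrable (fun s => T.scaledDrift (f s))
  cov : ∀ i j, Integrable (fun s => f s ^ 2 * T.cov i j)
  levy : ∫⁻ s, ∫⁻ x, capSq (f s • x) ∂T.levy < ∞

end CharTriplet

/-- The probability law `μ` on `ℝ^ι` is infinitely divisible with characteristic triplet `T`,
that is, `T` is a genuine triplet and the Lévy–Khintchine formula holds. -/
structure HasTriplet {ι : Type*} [Fintype ι] (μ : Measure (ι → ℝ)) (T : CharTriplet ι) :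
    Prop where
  isProbabilityMeasure : IsProbabilityMeasure μ
  isValid : T.IsValid
  charFun_eq : ∀ θ : ι → ℝ,
    ∫ x, Complex.exp (Complex.I * ((∑ i, θ i * x i : ℝ) : ℂ)) ∂μ = Complex.exp (T.exponent θ)

/-- The image of `ds ⊗ ν(dx)` under `(s, x) ↦ f(s) x`, i.e. `A ↦ ∫∫ 1_A(f(s) x) ν(dx) ds`, where
`s` runs through the set `S`. -/
def scaledImage {κ : Type*} (f : ℝ → ℝ) (S : Set ℝ) (ν : Measure (κ → ℝ)) : Measure (κ → ℝ) :=
  ((volume.restrict S).prod ν).map (fun p : ℝ × (κ → ℝ) => f p.1 • p.2)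

/-- The triplet attached to the integral `∫ f dL`, where `L` is a two-sided Lévy process whose
value at time one has triplet `T`. As always for Lévy measures, the origin carries no mass. -/
def integralTriplet {ι : Type*} [Fintype ι] (f : ℝ → ℝ) (T : CharTriplet ι) : CharTriplet ι where
  drift := ∫ s, T.scaledDrift (f s)
  cov := Matrix.of fun i j => ∫ s, f s ^ 2 * T.cov i j
  levy := (scaledImage f Set.univ T.levy).restrict {0}ᶜ

/-! ### Infinitely divisible fields -/

section Fields

variable {U : Type*}

/-- A law on `ℝ^U` is infinitely divisible if for every `n ≥ 1` it is the law of the sum of `n`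
independent identically distributed random fields. -/
def IsInfDivLaw (μ : Measure (U → ℝ)) : Prop :=
  ∀ n : ℕ, 1 ≤ n → ∃ ρ : Measure (U → ℝ), IsProbabilityMeasure ρ ∧
    (Measure.pi (fun _ : Fin n => ρ)).map (fun x => ∑ i, x i) = μ

/-- A measure on the cylindrical `σ`-algebra of `ℝ^U` does not charge zero. -/
def DoesNotChargeZero (ν : Measure (U → ℝ)) : Prop :=
  ∃ U₀ : Set U, U₀.Countable ∧ ν {x | ∀ u ∈ U₀, x u = 0} = 0

/-- `ν` is a pseudo master Lévy measure for a system of triplets. -/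
structure IsPseudoMaster (ν : Measure (U → ℝ)) (T : (u : Finset U) → CharTriplet u) : Prop where
  levy_eq : ∀ (u : Finset U) (A : Set (u → ℝ)), MeasurableSet A → (0 : u → ℝ) ∉ A →
    (T u).levy A = ν (u.restrict ⁻¹' A)
  cap_lt_top : ∀ u : U, ∫⁻ x, ENNReal.ofReal (min 1 (x u ^ 2)) ∂ν < ∞

/-- `ν` is the master Lévy measure for a system of triplets. -/
structure IsMaster (ν : Measure (U → ℝ)) (T : (u : Finset U) → CharTriplet u) : Prop extends
    IsPseudoMaster ν T where
  doesNotChargeZero : DoesNotChargeZero ν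

/-- The finite-dimensional triplets induced by `(Γ, B, ν)`. -/
def fieldTriplet (Γ : U → ℝ) (B : U → U → ℝ) (ν : Measure (U → ℝ)) (u : Finset U) :
    CharTriplet u where
  drift := u.restrict Γ
  cov := Matrix.of fun i j => B i j
  levy := (ν.map u.restrict).restrict {0}ᶜ

/-- A law `μ` on `ℝ^U` is that of an infinitely divisible field with characteristic triplet
`(Γ, B, ν)`, where `ν` is the master Lévy measure (so `ν` does not charge zero). -/
structure HasFieldTriplet (μ : Measure (U → ℝ)) (Γ : U → ℝ) (B : U → U → ℝ)
    (ν : Measure (U → ℝ)) : Prop where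
  isProbabilityMeasure : IsProbabilityMeasure μ
  isInfDiv : IsInfDivLaw μ
  hasTriplet : ∀ u : Finset U, HasTriplet (μ.map u.restrict) (fieldTriplet Γ B ν u)
  isMaster : IsMaster ν (fieldTriplet Γ B ν)

/-- A consistent system of characteristic triplets: drifts and covariances are the restrictions
of unique functions on `U` and `U × U`, and the Lévy measures are compatible with the
projections off the origin. -/
structure IsConsistent (T : (u : Finset U) → CharTriplet u) : Prop where
  isValid : ∀ u, (T u).IsValid
  drift : ∃! Γ : U → ℝ, ∀ u, (T u).drift = u.restrict Γ
  cov : ∃! B : U → U → ℝ, ∀ u, (T u).cov = Matrix.of fun i j : u => B i j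
  levy : ∀ (u v : Finset U) (huv : u ⊆ v) (A : Set (u → ℝ)), MeasurableSet A →
    (0 : u → ℝ) ∉ A → (T u).levy A = (T v).levy (Finset.restrict₂ (π := fun _ => ℝ) huv ⁻¹' A)

end Fields

/-! ### Two-sided Lévy processes and their integrals -/

section Integrals

variable {ι Ω : Type*} [Fintype ι] [MeasurableSpace Ω]

/-- A two-sided Lévy process (in law) in `ℝ^ι`. -/
structure IsTwoSidedLevy (P : Measure Ω) (L : ℝ → Ω → ι → ℝ) : Prop where
  measurable : ∀ t, Measurable (L t)
  zero : ∀ᵐ ω ∂P, L 0 ω = 0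
  indep : HasIndepIncrements L P
  stationary : ∀ s t : ℝ, s ≤ t → P.map (fun ω => L t ω - L s ω) = P.map (L (t - s))
  stochContinuous : ∀ t, TendstoInMeasure P L (𝓝 t) (L t)

/-- A step function on the line: the value `a i` is taken on `(t i, t (i+1)]`, and the value
zero outside `(t 0, t n]`. -/
structure StepFn where
  n : ℕ
  t : Fin (n + 1) → ℝ
  mono : Monotone t
  a : Fin n → ℝ

/-- The function `∑ a_i 1_{(t_i, t_{i+1}]}`. -/
def StepFn.eval (g : StepFn) (s : ℝ) : ℝ :=
  ∑ i : Fin g.n, (Set.Ioc (g.t i.castSucc) (g.t i.succ)).indicator (fun _ => g.a i) s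

/-- The elementary integral `∑ a_i (L(t_{i+1}) - L(t_i))`. -/
def StepFn.integral (g : StepFn) (L : ℝ → Ω → ι → ℝ) (ω : Ω) : ι → ℝ :=
  ∑ i : Fin g.n, g.a i • (L (g.t i.succ) ω - L (g.t i.castSucc) ω)

/-- `Z` is (a version of) the stochastic integral `∫ f dL`, where `L` is a two-sided Lévy process
whose value at time one has triplet `T`: it is the limit in probability of the elementary
integrals of step functions that converge to `f` almost everywhere and in the
Musielak–Orlicz modular of `T`. -/
def IsLevyIntegral (P : Measure Ω) (L : ℝ → Ω → ι → ℝ) (T : CharTriplet ι) (f : ℝ → ℝ)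
    (Z : Ω → ι → ℝ) : Prop :=
  AEMeasurable Z P ∧ ∃ g : ℕ → StepFn,
    (∀ᵐ s, Tendsto (fun k => (g k).eval s) atTop (𝓝 (f s))) ∧
    Tendsto (fun k => ∫⁻ s, T.modular ((g k).eval s - f s)) atTop (𝓝 0) ∧
    TendstoInMeasure P (fun k => (g k).integral L) atTop Z

end Integrals

end

/-! Everything rests on the Lévy–Khintchine exponent `ψ` of a finite-dimensional marginal. For a
step function the elementary integral is a sum of independent increments, so its exponent at `θ` is
`∫ ψ(g(s)θ) ds` (`StepFn.charFunPi_integral`). On each ray, `|ψ(rθ)|` is at most a constant times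
the modular of `r` (`norm_exponent_smul_le`), and the modular is subadditive up to a factor
(`modularReal_add_le`). Convergence almost everywhere and in modular therefore gives `L¹`
convergence of the exponents, and every limit in probability has exponent `∫ ψ(f(s)θ) ds`. Rescaling
the kernel (`exponent_smul`) and Fubini identify this with the exponent of the integrated triplet
(`exponent_integralTriplet`).

For the field, all finite-dimensional Lévy measures come from a single measure `ν`, which is
`σ`-finite because it does not charge zero. Scaling commutes with projections, so the image of `ds ⊗
ν` under `(s, x) ↦ f(s) x` has the required projections off the origin. Parameters with `f(s) = 0`
only create mass at the zero field; deleting them gives a measure that does not charge zero. A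
master measure is unique because it is determined on cylinders bounded away from zero in one
coordinate, and countably many such regions exhaust it (`IsMaster.eq`).

Existence of the field uses Lévy's continuity theorem to build a law from each valid triplet (a
shift, a Gaussian law and a limit of compensated compound Poisson laws), then Kolmogorov extension.
Infinite divisibility follows by running the same construction with the triplet divided by `n`. -/

/-! ### Kolmogorov's extension theorem for real-valued fields -/

section Kolmogorov

variable {ι : Type*}

/-- Compact cylinders whose finite intersections are nonempty have nonempty intersection. -/
theorem nonempty_iInter_compact_cylinders (I : ℕ → Finset ι) (K : ∀ n, Set (I n → ℝ))
    (hK : ∀ n, IsCompact (K n))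
    (hne : ∀ n, (⋂ i ≤ n, cylinder (α := fun _ => ℝ) (I i) (K i)).Nonempty) :
    (⋂ n, cylinder (α := fun _ => ℝ) (I n) (K n)).Nonempty := by
  classical
  -- A compact box for Tychonoff: the range of coordinate `u` is taken from the first `K n` that
  -- sees `u`, and coordinates seen by no `I n` are frozen at `0`.
  let Q : ι → Set ℝ := fun u => if h : ∃ n, u ∈ I n then
    (fun x : I (Nat.find h) → ℝ => x ⟨u, Nat.find_spec h⟩) '' K (Nat.find h) else {0}
  have hQc : ∀ u, IsCompact (Q u) := by
    intro u
    by_cases h : ∃ n, u ∈ I n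
    · simp only [Q, h, dite_true]
      exact (hK _).image (continuous_apply _)
    · simp only [Q, h, dite_false]
      exact isCompact_singleton
  have hQne : ∀ u, (Q u).Nonempty := by
    intro u
    by_cases h : ∃ n, u ∈ I n
    · simp only [Q, h, dite_true]
      obtain ⟨x, hx⟩ := hne (Nat.find h)
      exact ⟨_, _, Set.mem_iInter₂.1 hx _ le_rfl, rfl⟩
    · simp [Q, h]
  choose q hq using hQne
  let D : ℕ → Set (ι → ℝ) := fun n =>
    Set.univ.pi Q ∩ ⋂ i ≤ n, cylinder (α := fun _ => ℝ) (I i) (K i)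
  have hcl : ∀ n, IsClosed (⋂ i ≤ n, cylinder (α := fun _ => ℝ) (I i) (K i)) := fun n =>
    isClosed_biInter fun i _ => (hK i).isClosed.preimage (by fun_prop)
  have hDne : ∀ n, (D n).Nonempty := by
    intro n
    obtain ⟨x, hx⟩ := hne n
    -- Coordinates seen up to stage `n` already lie in the box; changing the others does not affect
    -- the first cylinders.
    refine ⟨fun u => if ∃ i ≤ n, u ∈ I i then x u else q u, ?_, ?_⟩
    · intro u _
      by_cases h : ∃ i ≤ n, u ∈ I i
      · obtain ⟨i, hi, hu⟩ := h
        have h' : ∃ n, u ∈ I n := ⟨i, hu⟩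
        have hle : Nat.find h' ≤ n := (Nat.find_min' h' hu).trans hi
        have h'' : ∃ i ≤ n, u ∈ I i := ⟨i, hi, hu⟩
        simp only [Q, h', dite_true, h'', if_true]
        exact ⟨_, Set.mem_iInter₂.1 hx _ hle, rfl⟩
      · simp only [h, if_false]
        exact hq u
    · refine Set.mem_iInter₂.2 fun i hi => ?_
      have := Set.mem_iInter₂.1 hx i hi
      rw [mem_cylinder] at this ⊢
      convert! this using 1
      ext u
      have h'' : ∃ j ≤ n, (u : ι) ∈ I j := ⟨i, hi, u.2⟩
      simp [Finset.restrict, h'']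
  obtain ⟨x, hx⟩ := IsCompact.nonempty_iInter_of_sequence_nonempty_isCompact_isClosed D
    (fun n => Set.inter_subset_inter_right _
      (Set.biInter_mono (fun i (hi : i ≤ n) => hi.trans n.le_succ) fun _ _ => le_rfl))
    hDne ((isCompact_univ_pi hQc).inter_right (hcl 0))
    (fun n => (isCompact_univ_pi hQc).isClosed.inter (hcl n))
  exact ⟨x, Set.mem_iInter.2 fun n =>
    Set.mem_iInter₂.1 (Set.mem_iInter.1 hx n).2 n le_rfl⟩

variable {P : ∀ J : Finset ι, Measure (J → ℝ)} [∀ J, IsFiniteMeasure (P J)]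

/-- Continuity at `∅` is what makes the content countably additive. If the contents stayed above `ε
> 0`, compact bases inside the given ones with total error below `ε` would give cylinders with
nonempty finite intersections, and compactness would put a point in `⋂ n, A n`. -/
theorem tendsto_projectiveFamilyContent_of_antitone
    (hP : IsProjectiveMeasureFamily (α := fun _ => ℝ) P)
    (A : ℕ → Set (ι → ℝ)) (hA : ∀ n, A n ∈ measurableCylinders fun _ : ι => ℝ)
    (hanti : Antitone A) (hinter : ⋂ n, A n = ∅) :
    Tendsto (fun n => projectiveFamilyContent hP (A n)) atTop (𝓝 0) := by
  set c := projectiveFamilyContent hP with hc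
  by_contra hcon
  have hmono : Antitone fun n => c (A n) := fun m n hmn =>
    projectiveFamilyContent_mono hP (hA n) (hA m) (hanti hmn)
  have hlim := tendsto_atTop_iInf hmono
  set ε := ⨅ n, c (A n)
  have hε : ε ≠ 0 := fun h => hcon (h ▸ hlim)
  have hεle : ∀ n, ε ≤ c (A n) := fun n => iInf_le _ n
  choose I S hS hAS using fun n => (mem_measurableCylinders (A n)).1 (hA n)
  obtain ⟨δ, hδ, hδsum⟩ := ENNReal.exists_pos_sum_of_countable' hε ℕ
  have hK : ∀ n, ∃ K ⊆ S n, IsCompact K ∧ P (I n) (S n \ K) < δ n := fun n =>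
    (hS n).exists_isCompact_sdiff_lt (measure_ne_top _ _) (hδ n).ne'
  choose K hKS hKc hKδ using hK
  have hCm : ∀ n, cylinder (α := fun _ => ℝ) (I n) (K n) ∈
      measurableCylinders fun _ : ι => ℝ := fun n =>
    (mem_measurableCylinders _).2 ⟨I n, K n, (hKc n).measurableSet, rfl⟩
  have hring := isSetRing_measurableCylinders (α := fun _ : ι => ℝ)
    (mα := fun _ => inferInstance)
  have hne : ∀ n, (⋂ i ≤ n, cylinder (α := fun _ => ℝ) (I i) (K i)).Nonempty := by
    intro n
    by_contra hempty
    rw [Set.not_nonempty_iff_eq_empty] at hempty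
    have hsub : A n ⊆ ⋃ i ∈ Finset.range (n + 1), A i \ cylinder (α := fun _ => ℝ) (I i) (K i) := by
      intro x hx
      have hx' : x ∉ ⋂ i ≤ n, cylinder (α := fun _ => ℝ) (I i) (K i) := by simp [hempty]
      simp only [Set.mem_iInter, not_forall] at hx'
      obtain ⟨i, hi, hxi⟩ := hx'
      refine Set.mem_iUnion₂.2 ⟨i, Finset.mem_range_succ_iff.2 hi, hanti hi hx, hxi⟩
    have hdm : ∀ i, A i \ cylinder (α := fun _ => ℝ) (I i) (K i) ∈
        measurableCylinders fun _ : ι => ℝ := fun i =>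
      hring.sdiff_mem (hA i) (hCm i)
    have h1 : c (A n) ≤
        ∑ i ∈ Finset.range (n + 1), c (A i \ cylinder (α := fun _ => ℝ) (I i) (K i)) :=
      (projectiveFamilyContent_mono hP (hA n)
        (hring.biUnion_mem _ fun i _ => hdm i) hsub).trans
        (addContent_biUnion_le hring fun i _ => hdm i)
    have h2 : ∀ i, c (A i \ cylinder (α := fun _ => ℝ) (I i) (K i)) ≤ δ i := by
      intro i
      have : A i \ cylinder (α := fun _ => ℝ) (I i) (K i)
          = cylinder (α := fun _ => ℝ) (I i) (S i \ K i) := by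
        rw [hAS i, sdiff_cylinder_same]
      rw [this, hc, projectiveFamilyContent_cylinder hP ((hS i).diff (hKc i).measurableSet)]
      exact (hKδ i).le
    have h3 : c (A n) < ε := (h1.trans (Finset.sum_le_sum fun i _ => h2 i)).trans_lt
      ((ENNReal.sum_le_tsum _).trans_lt hδsum)
    exact absurd (hεle n) (not_le.2 h3)
  obtain ⟨x, hx⟩ := nonempty_iInter_compact_cylinders I K hKc hne
  have : x ∈ ⋂ n, A n := by
    refine Set.mem_iInter.2 fun n => ?_
    rw [hAS n]
    exact hKS n (Set.mem_iInter.1 hx n)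
  simp [hinter] at this

/-- **Kolmogorov's extension theorem** for real-valued fields. -/
theorem exists_isProjectiveLimit (hP : IsProjectiveMeasureFamily (α := fun _ => ℝ) P) :
    ∃ μ : Measure (ι → ℝ), IsProjectiveLimit (α := fun _ => ℝ) μ P := by
  have hring := isSetRing_measurableCylinders (α := fun _ : ι => ℝ)
    (mα := fun _ => inferInstance)
  have hsub : (projectiveFamilyContent hP).IsSigmaSubadditive := by
    refine isSigmaSubadditive_of_addContent_iUnion_eq_tsum hring fun f hf hfU hd => ?_
    refine addContent_iUnion_eq_sum_of_tendsto_zero hring _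
      (fun s _ => projectiveFamilyContent_ne_top hP) ?_ hf hfU hd
    exact fun s hs hanti hinter =>
      tendsto_projectiveFamilyContent_of_antitone hP s hs hanti hinter
  refine ⟨(projectiveFamilyContent hP).measure isSetSemiring_measurableCylinders
    generateFrom_measurableCylinders.ge hsub, fun J => ?_⟩
  ext S hS
  rw [Measure.map_apply (Finset.measurable_restrict J) hS]
  exact (AddContent.measure_eq _ _ generateFrom_measurableCylinders.symm hsub
    (cylinder_mem_measurableCylinders J S hS)).trans (projectiveFamilyContent_cylinder hP hS)

end Kolmogorov

/-! ### Characteristic functions on `ℝ^ι` -/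

section CharFun

variable {ι : Type*} [Fintype ι]

/-- The linear functional `x ↦ ∑ i, θ i * x i`. -/
noncomputable def dotCLM (θ : ι → ℝ) : StrongDual ℝ (ι → ℝ) :=
  ∑ i, θ i • ContinuousLinearMap.proj (R := ℝ) (φ := fun _ : ι => ℝ) i

@[simp] theorem dotCLM_apply (θ x : ι → ℝ) : dotCLM θ x = ∑ i, θ i * x i := by
  simp [dotCLM]

/-- The characteristic function of a measure on `ℝ^ι`. -/
noncomputable def charFunPi (μ : Measure (ι → ℝ)) (θ : ι → ℝ) : ℂ :=
  ∫ x, Complex.exp (Complex.I * ((∑ i, θ i * x i : ℝ) : ℂ)) ∂μ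

theorem charFunPi_eq_charFunDual (μ : Measure (ι → ℝ)) (θ : ι → ℝ) :
    charFunPi μ θ = charFunDual μ (dotCLM θ) := by
  simp only [charFunPi, charFunDual_apply, dotCLM_apply, mul_comm Complex.I]

/-- Ensures that `charFunPi` carries all the information of `charFunDual`, so uniqueness transfers
to it. -/
theorem exists_dotCLM_eq (L : StrongDual ℝ (ι → ℝ)) : ∃ θ, dotCLM θ = L := by
  classical
  refine ⟨fun i => L (Pi.single i 1), ?_⟩
  ext x
  rw [dotCLM_apply]
  conv_rhs => rw [← Finset.univ_sum_single x, map_sum]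
  refine Finset.sum_congr rfl fun i _ => ?_
  have : (Pi.single i (x i) : ι → ℝ) = x i • Pi.single i 1 := by
    rw [← Pi.single_smul, smul_eq_mul, mul_one]
  rw [this, map_smul, smul_eq_mul, mul_comm]

theorem ext_of_charFunPi {μ ν : Measure (ι → ℝ)} [IsFiniteMeasure μ] [IsFiniteMeasure ν]
    (h : ∀ θ, charFunPi μ θ = charFunPi ν θ) : μ = ν := by
  refine Measure.ext_of_charFunDual ?_
  ext L
  obtain ⟨θ, rfl⟩ := exists_dotCLM_eq L
  rw [← charFunPi_eq_charFunDual, ← charFunPi_eq_charFunDual, h]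

theorem charFunPi_conv (μ ν : Measure (ι → ℝ)) [IsFiniteMeasure μ] [IsFiniteMeasure ν]
    (θ : ι → ℝ) : charFunPi (μ ∗ ν) θ = charFunPi μ θ * charFunPi ν θ := by
  rw [charFunPi_eq_charFunDual, charFunPi_eq_charFunDual, charFunPi_eq_charFunDual,
    charFunDual_conv]

theorem charFunPi_dirac (a θ : ι → ℝ) :
    charFunPi (Measure.dirac a) θ = Complex.exp (Complex.I * ((∑ i, θ i * a i : ℝ) : ℂ)) := by
  rw [charFunPi, integral_dirac]

theorem continuous_charFunPi (μ : Measure (ι → ℝ)) [IsFiniteMeasure μ] :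
    Continuous (charFunPi μ) := by
  refine continuous_of_dominated (bound := fun _ => 1) (fun θ => ?_) (fun θ => ?_)
    (integrable_const _) (ae_of_all _ fun x => by fun_prop)
  · exact Continuous.aestronglyMeasurable (by fun_prop)
  · refine ae_of_all _ fun x => ?_
    rw [mul_comm, Complex.norm_exp_ofReal_mul_I]

theorem charFunPi_zero (μ : Measure (ι → ℝ)) [IsProbabilityMeasure μ] : charFunPi μ 0 = 1 := by
  simp [charFunPi]

theorem charFun_map_toLp (μ : Measure (ι → ℝ)) (θ : ι → ℝ) :
    charFun (μ.map (WithLp.toLp 2 : (ι → ℝ) → EuclideanSpace ℝ ι)) (WithLp.toLp 2 θ)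
      = charFunPi μ θ := by
  rw [charFun_apply, integral_map (by fun_prop) (Continuous.aestronglyMeasurable (by fun_prop))]
  simp [charFunPi, PiLp.inner_apply, mul_comm Complex.I]

theorem charFunPi_map_ofLp (μ : Measure (EuclideanSpace ℝ ι)) (θ : ι → ℝ) :
    charFunPi (μ.map WithLp.ofLp) θ = charFun μ (WithLp.toLp 2 θ) := by
  rw [charFun_apply, charFunPi, integral_map (by fun_prop)
    (Continuous.aestronglyMeasurable (by fun_prop))]
  simp [PiLp.inner_apply, mul_comm Complex.I]

/-- **Lévy's continuity theorem**: a pointwise limit of characteristic functions which is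
continuous at the origin is a characteristic function. -/
theorem exists_charFunPi_eq_of_tendsto (μ : ℕ → Measure (ι → ℝ))
    [∀ n, IsProbabilityMeasure (μ n)] (φ : (ι → ℝ) → ℂ) (hφ : ContinuousAt φ 0)
    (h : ∀ θ, Tendsto (fun n => charFunPi (μ n) θ) atTop (𝓝 (φ θ))) :
    ∃ ρ : Measure (ι → ℝ), IsProbabilityMeasure ρ ∧ ∀ θ, charFunPi ρ θ = φ θ := by
  let E := EuclideanSpace ℝ ι
  have hm : Measurable (WithLp.toLp 2 : (ι → ℝ) → E) := by fun_prop
  let m : ℕ → ProbabilityMeasure E := fun n =>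
    ⟨(μ n).map (WithLp.toLp 2), Measure.isProbabilityMeasure_map hm.aemeasurable⟩
  have hm' : ∀ t : E, Tendsto (fun n => charFun (m n : Measure E) t) atTop
      (𝓝 (φ (WithLp.ofLp t))) := by
    intro t
    have := h (WithLp.ofLp t)
    simp_rw [← charFun_map_toLp] at this
    simpa [m] using this
  -- Continuity of the limit at the origin prevents mass from escaping to infinity.
  have htight : IsTightMeasureSet {((m n : ProbabilityMeasure E) : Measure E) | n} := by
    refine isTightMeasureSet_of_tendsto_charFun (μ := fun n => (m n : Measure E))
      (f := fun t => φ (WithLp.ofLp t)) ?_ hm'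
    exact ContinuousAt.comp (f := fun t : EuclideanSpace ℝ ι => WithLp.ofLp t) (g := φ)
      (by simpa using hφ) (PiLp.continuous_ofLp 2 _).continuousAt
  have hcomp : IsCompact (closure {m n | n}) :=
    isCompact_closure_of_isTightMeasureSet (by simpa using htight)
  -- A limit along one ultrafilter is enough: its characteristic function must agree with the full
  -- pointwise limit `φ`.
  let F : Ultrafilter ℕ := Ultrafilter.of atTop
  obtain ⟨ρ, -, hρ⟩ := hcomp.ultrafilter_le_nhds (F.map m)
    (.trans (by simp) (monotone_principal subset_closure))
  have hρ' : Tendsto m F (𝓝 ρ) := hρ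
  rw [ProbabilityMeasure.tendsto_iff_forall_integral_rclike_tendsto ℂ] at hρ'
  have hρc : ∀ t : E, charFun (ρ : Measure E) t = φ (WithLp.ofLp t) := by
    intro t
    refine tendsto_nhds_unique ?_ ((hm' t).mono_left (Ultrafilter.of_le atTop))
    simp_rw [charFun_eq_integral_innerProbChar]
    exact hρ' (BoundedContinuousFunction.innerProbChar t)
  refine ⟨(ρ : Measure E).map WithLp.ofLp,
    Measure.isProbabilityMeasure_map (by fun_prop), fun θ => ?_⟩
  rw [charFunPi_map_ofLp, hρc]

theorem charFunPi_map_sum_pi {n : ℕ} (ρ : Measure (ι → ℝ)) [IsProbabilityMeasure ρ]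
    (θ : ι → ℝ) :
    charFunPi ((Measure.pi fun _ : Fin n => ρ).map fun x => ∑ i, x i) θ = charFunPi ρ θ ^ n := by
  simp only [charFunPi_eq_charFunDual]
  have := charFunDual_map_sum_pi_eq_prod (μ := fun _ : Fin n => ρ)
  rw [this]
  simp

end CharFun

/-! ### The truncation function and the Lévy–Khintchine kernel -/

section Truncation

theorem abs_trunc_le_one (r : ℝ) : |trunc r| ≤ 1 := by
  rw [trunc, abs_div, abs_of_pos (by positivity : (0 : ℝ) < max 1 |r|)]
  exact div_le_one_of_le₀ (le_max_right _ _) (by positivity)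

theorem trunc_of_abs_le_one {r : ℝ} (h : |r| ≤ 1) : trunc r = r := by
  rw [trunc, max_eq_left h, div_one]

theorem trunc_zero : trunc 0 = 0 := trunc_of_abs_le_one (by simp)

theorem continuous_trunc : Continuous trunc :=
  continuous_id.div (by fun_prop) fun x => by positivity

theorem measurable_trunc : Measurable trunc := continuous_trunc.measurable

/-- The difference vanishes when `|y|` and `|r y|` are at most `1`. If only `|r y|` exceeds `1`, it
is at most `|r y| ≤ r² y²`; if `|y| > 1`, it is at most `1 + |r|`. -/
theorem abs_trunc_mul_sub_le (r y : ℝ) :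
    |trunc (r * y) - r * trunc y| ≤ (1 + |r| + r ^ 2) * min 1 (y ^ 2) := by
  have hr : 0 ≤ |r| := abs_nonneg r
  rcases le_or_gt |y| 1 with hy | hy
  · have hy2 : y ^ 2 ≤ 1 := by rw [← sq_abs]; nlinarith [abs_nonneg y]
    rw [trunc_of_abs_le_one hy, min_eq_right hy2]
    rcases le_or_gt |r * y| 1 with hry | hry
    · rw [trunc_of_abs_le_one hry, sub_self, abs_zero]
      positivity
    · have h1 : |trunc (r * y) - r * y| ≤ |r * y| := by
        have hm : (1 : ℝ) < max 1 |r * y| := lt_max_of_lt_right hry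
        have : trunc (r * y) - r * y = -((r * y) * (1 - 1 / max 1 |r * y|)) := by
          rw [trunc]; field_simp; ring
        rw [this, abs_neg, abs_mul]
        refine mul_le_of_le_one_right (abs_nonneg _) ?_
        have h2 : 0 < 1 / max 1 |r * y| := by positivity
        have h3 : 1 / max 1 |r * y| ≤ 1 := by
          rw [div_le_one (by positivity)]; exact hm.le
        rw [abs_of_nonneg (by linarith)]
        linarith
      have h2 : |r * y| ≤ r ^ 2 * y ^ 2 := by
        rw [← mul_pow, ← sq_abs (r * y)]
        nlinarith
      nlinarith [sq_nonneg y, mul_nonneg hr (sq_nonneg y)]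
  · have hy2 : 1 ≤ y ^ 2 := by rw [← sq_abs]; nlinarith
    rw [min_eq_left hy2]
    have h1 := abs_trunc_le_one (r * y)
    have h2 : |r * trunc y| ≤ |r| := by
      rw [abs_mul]
      exact mul_le_of_le_one_right hr (abs_trunc_le_one y)
    have h3 := abs_sub (trunc (r * y)) (r * trunc y)
    nlinarith [sq_nonneg r]

/-- Truncation is additive near zero and its defect is always at most `3`. Once `|y|` or `|z|`
exceeds `1/2`, the corresponding minimum is at least `1/4`, whence `12 = 3 · 4`. -/
theorem abs_trunc_add_sub_le (y z : ℝ) :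
    |trunc (y + z) - trunc y - trunc z| ≤ 12 * (min 1 (y ^ 2) + min 1 (z ^ 2)) := by
  have hy0 : 0 ≤ min 1 (y ^ 2) := by positivity
  have hz0 : 0 ≤ min 1 (z ^ 2) := by positivity
  by_cases h : |y| ≤ 1 / 2 ∧ |z| ≤ 1 / 2
  · obtain ⟨hy, hz⟩ := h
    rw [trunc_of_abs_le_one (by linarith : |y| ≤ 1), trunc_of_abs_le_one (by linarith : |z| ≤ 1),
      trunc_of_abs_le_one ((abs_add_le y z).trans (by linarith))]
    rw [add_sub_cancel_left, sub_self, abs_zero]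
    positivity
  · have h3 : |trunc (y + z) - trunc y - trunc z| ≤ 3 := by
      have h1 := abs_le.1 (abs_trunc_le_one (y + z))
      have h2 := abs_le.1 (abs_trunc_le_one y)
      have h3 := abs_le.1 (abs_trunc_le_one z)
      rw [abs_le]
      constructor <;> linarith [h1.1, h1.2, h2.1, h2.2, h3.1, h3.2]
    have h4 : ∀ w : ℝ, 1 / 2 < |w| → 1 / 4 ≤ min 1 (w ^ 2) := fun w hw => by
      refine le_min (by norm_num) ?_
      rw [← sq_abs]; nlinarith
    rw [not_and_or, not_le, not_le] at h
    rcases h with h | h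
    · linarith [h4 y h]
    · linarith [h4 z h]

theorem continuous_truncVec {ι : Type*} : Continuous (truncVec : (ι → ℝ) → ι → ℝ) :=
  continuous_pi fun i => continuous_trunc.comp (continuous_apply i)

theorem continuous_truncVec_smul_sub {ι : Type*} :
    Continuous fun p : ℝ × (ι → ℝ) => truncVec (p.1 • p.2) - p.1 • truncVec p.2 :=
  (continuous_truncVec.comp continuous_smul).sub
    (continuous_fst.smul (continuous_truncVec.comp continuous_snd))

end Truncation

section Kernel

variable {ι : Type*} [Fintype ι]

/-- `1 ∧ |x|²` as a real number. -/
noncomputable def capSqReal (x : ι → ℝ) : ℝ := min 1 (∑ i, x i ^ 2)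

theorem capSqReal_nonneg (x : ι → ℝ) : 0 ≤ capSqReal x :=
  le_min zero_le_one (Finset.sum_nonneg fun _ _ => sq_nonneg _)

theorem continuous_capSqReal : Continuous (capSqReal : (ι → ℝ) → ℝ) := by
  unfold capSqReal; fun_prop

theorem measurable_capSq : Measurable (capSq : (ι → ℝ) → ℝ≥0∞) :=
  continuous_capSqReal.measurable.ennreal_ofReal

theorem min_one_sq_le_capSqReal (x : ι → ℝ) (i : ι) : min 1 (x i ^ 2) ≤ capSqReal x :=
  min_le_min le_rfl
    (Finset.single_le_sum (f := fun i => x i ^ 2) (fun _ _ => sq_nonneg _) (Finset.mem_univ i))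

theorem capSqReal_smul_le (r : ℝ) (x : ι → ℝ) :
    capSqReal (r • x) ≤ (1 + r ^ 2) * capSqReal x := by
  have hs : ∑ i, (r • x) i ^ 2 = r ^ 2 * ∑ i, x i ^ 2 := by
    simp [mul_pow, Finset.mul_sum]
  have h0 : 0 ≤ ∑ i, x i ^ 2 := Finset.sum_nonneg fun _ _ => sq_nonneg _
  unfold capSqReal
  rw [hs]
  rcases le_total 1 (∑ i, x i ^ 2) with h | h
  · rw [min_eq_left h]
    exact (min_le_left _ _).trans (by nlinarith [sq_nonneg r])
  · rw [min_eq_right h]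
    exact (min_le_right _ _).trans (by nlinarith)

theorem capSqReal_add_le (x y : ι → ℝ) :
    capSqReal (x + y) ≤ 2 * (capSqReal x + capSqReal y) := by
  have hs : ∑ i, (x + y) i ^ 2 ≤ 2 * (∑ i, x i ^ 2 + ∑ i, y i ^ 2) := by
    rw [← Finset.sum_add_distrib, Finset.mul_sum]
    exact Finset.sum_le_sum fun i _ => by
      rw [Pi.add_apply]; nlinarith [sq_nonneg (x i - y i)]
  have hx : 0 ≤ ∑ i, x i ^ 2 := Finset.sum_nonneg fun _ _ => sq_nonneg _
  have hy : 0 ≤ ∑ i, y i ^ 2 := Finset.sum_nonneg fun _ _ => sq_nonneg _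
  unfold capSqReal
  rcases le_total 1 (∑ i, x i ^ 2) with h | h
  · rw [min_eq_left h]
    have : 0 ≤ min 1 (∑ i, y i ^ 2) := by positivity
    exact (min_le_left _ _).trans (by linarith)
  · rw [min_eq_right h]
    rcases le_total 1 (∑ i, y i ^ 2) with h' | h'
    · rw [min_eq_left h']
      exact (min_le_left _ _).trans (by linarith)
    · rw [min_eq_right h']
      exact (min_le_right _ _).trans hs

/-- The integrand `exp(i⟨θ, x⟩) - 1 - i⟨θ, τ(x)⟩` of the Lévy–Khintchine formula. -/
noncomputable def levyKernel (θ x : ι → ℝ) : ℂ :=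
  Complex.exp (Complex.I * ((∑ i, θ i * x i : ℝ) : ℂ)) - 1
    - Complex.I * ((∑ i, θ i * truncVec x i : ℝ) : ℂ)

theorem continuous_levyKernel_right (θ : ι → ℝ) : Continuous (levyKernel θ) := by
  unfold levyKernel
  have : Continuous (truncVec : (ι → ℝ) → ι → ℝ) := continuous_truncVec
  fun_prop

theorem levyKernel_zero_right (θ : ι → ℝ) : levyKernel θ 0 = 0 := by
  simp [levyKernel, truncVec, trunc_zero]

theorem norm_exp_I_mul_sub_le (y : ℝ) :
    ‖Complex.exp (Complex.I * (y : ℂ)) - 1 - Complex.I * (y : ℂ)‖ ≤ 3 * y ^ 2 := by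
  have hn : ‖Complex.I * (y : ℂ)‖ = |y| := by simp
  rcases le_or_gt |y| 1 with hy | hy
  · have := Complex.norm_exp_sub_one_sub_id_le (x := Complex.I * (y : ℂ)) (by rwa [hn])
    rw [hn, sq_abs] at this
    nlinarith [sq_nonneg y]
  · have h1 : ‖Complex.exp (Complex.I * (y : ℂ))‖ = 1 := by
      rw [mul_comm, Complex.norm_exp_ofReal_mul_I]
    have h2 := norm_sub_le (Complex.exp (Complex.I * (y : ℂ)) - 1) (Complex.I * (y : ℂ))
    have h3 := norm_sub_le (Complex.exp (Complex.I * (y : ℂ))) 1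
    rw [hn] at h2
    rw [h1, norm_one] at h3
    rw [← sq_abs y]
    nlinarith

/-- The constant in the bound of the Lévy–Khintchine integrand by `1 ∧ |x|²`. -/
noncomputable def levyKernelBound (θ : ι → ℝ) : ℝ := 2 + ∑ i, |θ i| + 3 * ∑ i, θ i ^ 2

theorem continuous_levyKernelBound : Continuous (levyKernelBound : (ι → ℝ) → ℝ) := by
  unfold levyKernelBound; fun_prop

theorem levyKernelBound_nonneg (θ : ι → ℝ) : 0 ≤ levyKernelBound θ := by
  unfold levyKernelBound; positivity

theorem abs_sum_mul_truncVec_le (θ x : ι → ℝ) : |∑ i, θ i * truncVec x i| ≤ ∑ i, |θ i| :=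
  (Finset.abs_sum_le_sum_abs _ _).trans <| Finset.sum_le_sum fun i _ => by
    rw [abs_mul]; exact mul_le_of_le_one_right (abs_nonneg _) (abs_trunc_le_one _)

/-- Inside the unit ball truncation is the identity and the kernel is of second order, by
Cauchy–Schwarz; outside, each of its terms is bounded. -/
theorem norm_levyKernel_le (θ x : ι → ℝ) :
    ‖levyKernel θ x‖ ≤ levyKernelBound θ * capSqReal x := by
  have ha : 0 ≤ ∑ i, |θ i| := by positivity
  have hb : 0 ≤ ∑ i, θ i ^ 2 := by positivity
  unfold capSqReal levyKernelBound
  rcases le_total (∑ i, x i ^ 2) 1 with h | h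
  · have hτ : truncVec x = x := by
      ext i
      refine trunc_of_abs_le_one ((sq_le_one_iff_abs_le_one _).1 (le_trans ?_ h))
      exact Finset.single_le_sum (f := fun i => x i ^ 2) (fun _ _ => sq_nonneg _)
        (Finset.mem_univ i)
    rw [min_eq_right h, levyKernel, hτ]
    have h1 := norm_exp_I_mul_sub_le (∑ i, θ i * x i)
    have h2 := Finset.sum_mul_sq_le_sq_mul_sq Finset.univ θ x
    have h0 : 0 ≤ ∑ i, x i ^ 2 := by positivity
    nlinarith [mul_nonneg ha h0]
  · rw [min_eq_left h, mul_one, levyKernel]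
    have h1 : ‖Complex.exp (Complex.I * ((∑ i, θ i * x i : ℝ) : ℂ))‖ = 1 := by
      rw [mul_comm, Complex.norm_exp_ofReal_mul_I]
    have h2 := norm_sub_le (Complex.exp (Complex.I * ((∑ i, θ i * x i : ℝ) : ℂ)) - 1)
      (Complex.I * ((∑ i, θ i * truncVec x i : ℝ) : ℂ))
    have h3 := norm_sub_le (Complex.exp (Complex.I * ((∑ i, θ i * x i : ℝ) : ℂ))) 1
    rw [norm_mul, Complex.norm_I, one_mul, Complex.norm_real, Real.norm_eq_abs] at h2
    rw [h1, norm_one] at h3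
    have := abs_sum_mul_truncVec_le θ x
    linarith

end Kernel

/-! ### Integrability and `σ`-finiteness for Lévy measures. -/

section LevyMeasure

variable {ι : Type*} [Fintype ι] {ν : Measure (ι → ℝ)}

/-- A measure is `σ`-finite if almost every point is charged by one of countably many functions
with finite integrals. -/
theorem sigmaFinite_of_lintegral_ne_top {α κ : Type*} [Countable κ] [MeasurableSpace α]
    {μ : Measure α} (g : κ → α → ℝ≥0∞) (hg : ∀ k, Measurable (g k))
    (hfin : ∀ k, ∫⁻ x, g k x ∂μ < ∞) (hnull : μ {x | ∀ k, g k x = 0} = 0) : SigmaFinite μ := by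
  -- Superlevel sets at `1/(n+1)` have finite measure by Markov's inequality, and with the null set
  -- they cover the space.
  let S : Set (Set α) := insert {x | ∀ k, g k x = 0}
    (Set.range fun p : κ × ℕ => {x | ((p.2 : ℝ≥0∞) + 1)⁻¹ ≤ g p.1 x})
  refine Measure.sigmaFinite_of_countable (S := S) ((Set.countable_range _).insert _) ?_ ?_
  · rintro s (rfl | ⟨p, rfl⟩)
    · simp [hnull]
    · refine lt_of_le_of_lt (meas_ge_le_lintegral_div (hg p.1).aemeasurable ?_ ?_)
        (ENNReal.div_lt_top (hfin p.1).ne ?_)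
      · simp
      · simp
      · simp
  · rw [Set.eq_univ_iff_forall]
    intro x
    by_cases h : ∀ k, g k x = 0
    · exact ⟨_, Set.mem_insert _ _, h⟩
    · push Not at h
      obtain ⟨k, hk⟩ := h
      obtain ⟨n, hn⟩ := ENNReal.exists_inv_nat_lt hk
      refine ⟨_, Set.mem_insert_of_mem _ ⟨(k, n), rfl⟩, ?_⟩
      refine le_trans ?_ hn.le
      exact ENNReal.inv_le_inv.2 le_self_add

theorem IsLevyMeasure.sigmaFinite (h : IsLevyMeasure ν) : SigmaFinite ν := by
  refine sigmaFinite_of_lintegral_ne_top (fun _ : Unit => capSq) (fun _ => measurable_capSq)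
    (fun _ => h.capSq_lt_top) (measure_mono_null (fun x hx => ?_) h.zero_null)
  have h0 : capSqReal x = 0 :=
    le_antisymm (ENNReal.ofReal_eq_zero.1 (hx ())) (capSqReal_nonneg x)
  ext i
  have := min_one_sq_le_capSqReal x i
  rw [h0] at this
  by_contra hne
  have : 0 < x i ^ 2 := lt_of_le_of_ne (sq_nonneg _) (Ne.symm (pow_ne_zero 2 hne))
  have : 0 < min 1 (x i ^ 2) := lt_min one_pos this
  linarith

theorem IsLevyMeasure.integrable_capSqReal (h : IsLevyMeasure ν) : Integrable capSqReal ν := by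
  refine ⟨continuous_capSqReal.aestronglyMeasurable, ?_⟩
  rw [hasFiniteIntegral_iff_ofReal (ae_of_all _ capSqReal_nonneg)]
  exact h.capSq_lt_top

theorem IsLevyMeasure.integrable_capSqReal_smul (h : IsLevyMeasure ν) (r : ℝ) :
    Integrable (fun x => capSqReal (r • x)) ν :=
  (h.integrable_capSqReal.const_mul (1 + r ^ 2)).mono'
    (continuous_capSqReal.comp (continuous_const_smul r)).aestronglyMeasurable
    (ae_of_all _ fun x => by
      rw [Real.norm_of_nonneg (capSqReal_nonneg _)]; exact capSqReal_smul_le r x)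

theorem IsLevyMeasure.integrable_levyKernel (h : IsLevyMeasure ν) (θ : ι → ℝ) :
    Integrable (levyKernel θ) ν :=
  (h.integrable_capSqReal.const_mul _).mono'
    (continuous_levyKernel_right θ).aestronglyMeasurable
    (ae_of_all _ (norm_levyKernel_le θ))

theorem IsLevyMeasure.integrable_levyKernel_smul (h : IsLevyMeasure ν) (θ : ι → ℝ) (r : ℝ) :
    Integrable (fun x => levyKernel θ (r • x)) ν :=
  ((h.integrable_capSqReal_smul r).const_mul (levyKernelBound θ)).mono'
    ((continuous_levyKernel_right θ).comp (continuous_const_smul r)).aestronglyMeasurable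
    (ae_of_all _ fun x => norm_levyKernel_le θ (r • x))

theorem norm_truncVec_smul_sub_le (r : ℝ) (x : ι → ℝ) :
    ‖truncVec (r • x) - r • truncVec x‖ ≤ (1 + |r| + r ^ 2) * capSqReal x := by
  refine (pi_norm_le_iff_of_nonneg (mul_nonneg (by positivity) (capSqReal_nonneg x))).2
    fun i => (abs_trunc_mul_sub_le r (x i)).trans ?_
  exact mul_le_mul_of_nonneg_left (min_one_sq_le_capSqReal x i) (by positivity)

theorem IsLevyMeasure.integrable_truncVec_smul_sub (h : IsLevyMeasure ν) (r : ℝ) :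
    Integrable (fun x => truncVec (r • x) - r • truncVec x) ν :=
  (h.integrable_capSqReal.const_mul (1 + |r| + r ^ 2)).mono'
    (continuous_truncVec_smul_sub.comp (Continuous.prodMk_right r)).aestronglyMeasurable
    (ae_of_all _ (norm_truncVec_smul_sub_le r))

theorem norm_truncVec_add_smul_sub_le (a b : ℝ) (x : ι → ℝ) :
    ‖truncVec ((a + b) • x) - truncVec (a • x) - truncVec (b • x)‖
      ≤ 12 * (capSqReal (a • x) + capSqReal (b • x)) := by
  have h1 := capSqReal_nonneg (a • x)
  have h2 := capSqReal_nonneg (b • x)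
  refine (pi_norm_le_iff_of_nonneg (by positivity)).2 fun i => ?_
  have h := abs_trunc_add_sub_le (a * x i) (b * x i)
  rw [← add_mul] at h
  exact h.trans (mul_le_mul_of_nonneg_left (add_le_add (min_one_sq_le_capSqReal (a • x) i)
    (min_one_sq_le_capSqReal (b • x) i)) (by norm_num))

end LevyMeasure

/-! ### Exponents of triplets and the Musielak–Orlicz modular -/

section QuadraticForm

variable {ι : Type*} [Fintype ι] {B : Matrix ι ι ℝ}

theorem quadForm_eq_dotProduct (B : Matrix ι ι ℝ) (θ : ι → ℝ) :
    ∑ i, ∑ j, θ i * B i j * θ j = dotProduct (star θ) (B.mulVec θ) := by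
  simp only [dotProduct, Matrix.mulVec, Finset.mul_sum, star_trivial, mul_assoc]

theorem quadForm_nonneg (hB : B.PosSemidef) (θ : ι → ℝ) :
    0 ≤ ∑ i, ∑ j, θ i * B i j * θ j := by
  rw [quadForm_eq_dotProduct]
  exact hB.dotProduct_mulVec_nonneg θ

theorem posSemidef_of_quadForm_nonneg (hs : ∀ i j, B j i = B i j)
    (h : ∀ θ : ι → ℝ, 0 ≤ ∑ i, ∑ j, θ i * B i j * θ j) : B.PosSemidef := by
  refine Matrix.PosSemidef.of_dotProduct_mulVec_nonneg ?_ fun θ => ?_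
  · ext i j; simp [hs]
  · rw [← quadForm_eq_dotProduct]; exact h θ

/-- Writing `B = C* C`, the form is `|Cθ|²` and the trace is the squared Hilbert–Schmidt norm of
`C`, so Cauchy–Schwarz on each row suffices. -/
theorem quadForm_le_trace (hB : B.PosSemidef) (θ : ι → ℝ) :
    ∑ i, ∑ j, θ i * B i j * θ j ≤ (∑ i, θ i ^ 2) * B.trace := by
  classical
  open scoped MatrixOrder in
  obtain ⟨C, rfl⟩ := CStarAlgebra.nonneg_iff_eq_star_mul_self.mp hB.nonneg
  have h1 : ∑ i, ∑ j, θ i * (star C * C) i j * θ j = ∑ k, (∑ i, C k i * θ i) ^ 2 := by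
    rw [quadForm_eq_dotProduct, ← Matrix.mulVec_mulVec, Matrix.dotProduct_mulVec,
      Matrix.star_eq_conjTranspose, Matrix.vecMul_conjTranspose, star_star]
    simp only [dotProduct, Matrix.mulVec, star_trivial, sq]
  have h2 : (star C * C).trace = ∑ k, ∑ i, C k i ^ 2 := by
    simp only [Matrix.trace, Matrix.diag, Matrix.mul_apply, Matrix.star_apply, star_trivial, sq]
    exact Finset.sum_comm
  rw [h1, h2, Finset.mul_sum]
  refine Finset.sum_le_sum fun k _ => ?_
  rw [mul_comm]
  exact Finset.sum_mul_sq_le_sq_mul_sq Finset.univ (C k) θ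

end QuadraticForm

/-! ### Bounds of the exponent by the modular. -/

section Exponent

theorem integrable_complexOfReal {α : Type*} [MeasurableSpace α] {μ : Measure α} {g : α → ℝ}
    (hg : Integrable g μ) : Integrable (fun x => (g x : ℂ)) μ :=
  Complex.ofRealCLM.integrable_comp hg

namespace CharTriplet

variable {ι : Type*} [Fintype ι] {T : CharTriplet ι}

theorem exponent_eq (T : CharTriplet ι) (θ : ι → ℝ) :
    T.exponent θ = Complex.I * ((∑ i, θ i * T.drift i : ℝ) : ℂ)
      - ((1 / 2 * ∑ i, ∑ j, θ i * T.cov i j * θ j : ℝ) : ℂ) + ∫ x, levyKernel θ x ∂T.levy := rfl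

theorem exponent_zero (T : CharTriplet ι) : T.exponent 0 = 0 := by
  simp [exponent]

/-- Truncation is not homogeneous: moving `r` from `θ` to `x` leaves the error `τ(r x) - r τ(x)`,
which is linear in `θ` after pairing and joins the drift. This is the origin of `scaledDrift`. -/
theorem exponent_smul (h : T.IsValid) (r : ℝ) (θ : ι → ℝ) :
    T.exponent (r • θ) = Complex.I * ((∑ i, θ i * T.scaledDrift r i : ℝ) : ℂ)
      - ((1 / 2 * (r ^ 2 * ∑ i, ∑ j, θ i * T.cov i j * θ j) : ℝ) : ℂ)
      + ∫ x, levyKernel θ (r • x) ∂T.levy := by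
  have hV := h.isLevyMeasure.integrable_truncVec_smul_sub r
  have hK := h.isLevyMeasure.integrable_levyKernel_smul θ r
  have hk : ∀ x, levyKernel (r • θ) x = levyKernel θ (r • x)
      + Complex.I * ((dotCLM θ (truncVec (r • x) - r • truncVec x) : ℝ) : ℂ) := by
    intro x
    rw [dotCLM_apply]
    simp only [levyKernel, Pi.smul_apply, Pi.sub_apply, smul_eq_mul, mul_sub,
      Finset.sum_sub_distrib, Complex.ofReal_sub]
    have h1 : ∑ i, r * θ i * x i = ∑ i, θ i * (r * x i) :=
      Finset.sum_congr rfl fun i _ => by ring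
    have h2 : ∑ i, r * θ i * truncVec x i = ∑ i, θ i * (r * truncVec x i) :=
      Finset.sum_congr rfl fun i _ => by ring
    rw [h1, h2]
    ring
  have hint : ∫ x, levyKernel (r • θ) x ∂T.levy = (∫ x, levyKernel θ (r • x) ∂T.levy)
      + Complex.I * ((dotCLM θ (∫ x, (truncVec (r • x) - r • truncVec x) ∂T.levy) : ℝ) : ℂ) := by
    simp_rw [hk]
    have hd : Integrable (fun x => dotCLM θ (truncVec (r • x) - r • truncVec x)) T.levy :=
      (dotCLM θ).integrable_comp hV
    rw [integral_add hK ((integrable_complexOfReal hd).const_mul _), integral_const_mul,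
      integral_complex_ofReal,
      ContinuousLinearMap.integral_comp_comm _ hV]
  have hq : ∑ i, ∑ j, (r • θ) i * T.cov i j * (r • θ) j
      = r ^ 2 * ∑ i, ∑ j, θ i * T.cov i j * θ j := by
    simp only [Finset.mul_sum, Pi.smul_apply, smul_eq_mul]
    exact Finset.sum_congr rfl fun i _ => Finset.sum_congr rfl fun j _ => by ring
  have hd : ∑ i, θ i * T.scaledDrift r i = ∑ i, (r • θ) i * T.drift i
      + dotCLM θ (∫ x, (truncVec (r • x) - r • truncVec x) ∂T.levy) := by
    rw [dotCLM_apply, ← Finset.sum_add_distrib]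
    refine Finset.sum_congr rfl fun i _ => ?_
    simp only [scaledDrift, Pi.add_apply, Pi.smul_apply, smul_eq_mul]
    ring
  rw [exponent_eq, hint, hq, hd]
  push_cast
  ring

theorem continuous_exponent (h : T.IsValid) : Continuous T.exponent := by
  have hK : Continuous fun θ => ∫ x, levyKernel θ x ∂T.levy := by
    rw [continuous_iff_continuousAt]
    intro θ₀
    have hev : ∀ᶠ θ in 𝓝 θ₀, levyKernelBound θ < levyKernelBound θ₀ + 1 :=
      continuous_levyKernelBound.continuousAt.eventually_lt continuousAt_const (by simp)
    refine continuousAt_of_dominated (bound := fun x => (levyKernelBound θ₀ + 1) * capSqReal x)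
      (.of_forall fun θ => (continuous_levyKernel_right θ).aestronglyMeasurable) ?_
      (h.isLevyMeasure.integrable_capSqReal.const_mul _) (ae_of_all _ fun x => ?_)
    · filter_upwards [hev] with θ hθ
      exact ae_of_all _ fun x => (norm_levyKernel_le θ x).trans
        (mul_le_mul_of_nonneg_right hθ.le (capSqReal_nonneg x))
    · have : Continuous fun θ : ι → ℝ => levyKernel θ x := by
        unfold levyKernel; fun_prop
      exact this.continuousAt
  have : T.exponent = fun θ => Complex.I * ((∑ i, θ i * T.drift i : ℝ) : ℂ)
      - ((1 / 2 * ∑ i, ∑ j, θ i * T.cov i j * θ j : ℝ) : ℂ) + ∫ x, levyKernel θ x ∂T.levy := rfl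
  rw [this]
  fun_prop

/-- The modular of a triplet as a real number. -/
noncomputable def modularReal (T : CharTriplet ι) (r : ℝ) : ℝ :=
  ‖T.scaledDrift r‖ + r ^ 2 * T.cov.trace + ∫ x, capSqReal (r • x) ∂T.levy

theorem IsValid.trace_nonneg (h : T.IsValid) : 0 ≤ T.cov.trace := h.cov_posSemidef.trace_nonneg

theorem modularReal_nonneg (h : T.IsValid) (r : ℝ) : 0 ≤ T.modularReal r := by
  have h1 := mul_nonneg (sq_nonneg r) h.trace_nonneg
  have h2 : 0 ≤ ∫ x, capSqReal (r • x) ∂T.levy := integral_nonneg fun x => capSqReal_nonneg _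
  unfold modularReal
  positivity

theorem modular_eq_ofReal (h : T.IsValid) (r : ℝ) :
    T.modular r = ENNReal.ofReal (T.modularReal r) := by
  have h1 := mul_nonneg (sq_nonneg r) h.trace_nonneg
  have h2 : 0 ≤ ∫ x, capSqReal (r • x) ∂T.levy := integral_nonneg fun x => capSqReal_nonneg _
  rw [modularReal, ENNReal.ofReal_add (by positivity) h2,
    ENNReal.ofReal_add (norm_nonneg _) h1, ofReal_norm, modular,
    ofReal_integral_eq_lintegral_ofReal (h.isLevyMeasure.integrable_capSqReal_smul r)
      (ae_of_all _ fun x => capSqReal_nonneg _)]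
  rfl

/-- Drift, Gaussian and jump parts of the exponent are each controlled by the matching summand of
the modular. This turns modular convergence into `L¹` control of exponents. -/
theorem norm_exponent_smul_le (h : T.IsValid) (r : ℝ) (θ : ι → ℝ) :
    ‖T.exponent (r • θ)‖ ≤ levyKernelBound θ * T.modularReal r := by
  have ha : 0 ≤ ∑ i, |θ i| := by positivity
  have hb : 0 ≤ ∑ i, θ i ^ 2 := by positivity
  have h1 : |∑ i, θ i * T.scaledDrift r i| ≤ (∑ i, |θ i|) * ‖T.scaledDrift r‖ := by
    rw [Finset.sum_mul]
    refine (Finset.abs_sum_le_sum_abs _ _).trans (Finset.sum_le_sum fun i _ => ?_)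
    rw [abs_mul]
    exact mul_le_mul_of_nonneg_left (norm_le_pi_norm (T.scaledDrift r) i) (abs_nonneg _)
  have hq0 := quadForm_nonneg h.cov_posSemidef θ
  have hq := quadForm_le_trace h.cov_posSemidef θ
  have h2 : |1 / 2 * (r ^ 2 * ∑ i, ∑ j, θ i * T.cov i j * θ j)|
      ≤ (∑ i, θ i ^ 2) * (r ^ 2 * T.cov.trace) := by
    rw [abs_of_nonneg (by positivity)]
    nlinarith [mul_le_mul_of_nonneg_left hq (sq_nonneg r), mul_nonneg (sq_nonneg r) hq0]
  have h3 : ‖∫ x, levyKernel θ (r • x) ∂T.levy‖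
      ≤ levyKernelBound θ * ∫ x, capSqReal (r • x) ∂T.levy := by
    rw [← integral_const_mul]
    exact norm_integral_le_of_norm_le
      ((h.isLevyMeasure.integrable_capSqReal_smul r).const_mul _)
      (ae_of_all _ fun x => norm_levyKernel_le θ (r • x))
  have h4 := mul_nonneg (sq_nonneg r) h.trace_nonneg
  have h5 : 0 ≤ ‖T.scaledDrift r‖ := norm_nonneg _
  rw [exponent_smul h]
  refine (norm_add_le _ _).trans ?_
  have h6 := norm_sub_le (Complex.I * ((∑ i, θ i * T.scaledDrift r i : ℝ) : ℂ))
    ((1 / 2 * (r ^ 2 * ∑ i, ∑ j, θ i * T.cov i j * θ j) : ℝ) : ℂ)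
  rw [norm_mul, Complex.norm_I, one_mul, Complex.norm_real, Complex.norm_real,
    Real.norm_eq_abs, Real.norm_eq_abs] at h6
  have h7 : (∑ i, |θ i|) * ‖T.scaledDrift r‖ ≤ levyKernelBound θ * ‖T.scaledDrift r‖ :=
    mul_le_mul_of_nonneg_right (by unfold levyKernelBound; linarith) h5
  have h8 : (∑ i, θ i ^ 2) * (r ^ 2 * T.cov.trace)
      ≤ levyKernelBound θ * (r ^ 2 * T.cov.trace) :=
    mul_le_mul_of_nonneg_right (by unfold levyKernelBound; linarith) h4
  rw [modularReal, mul_add, mul_add]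
  linarith

/-- The scaled drift is additive up to the integral of `τ((a+b)x) - τ(ax) - τ(bx)`, since the linear
compensators cancel. That defect costs `12` times the jump terms; the jump term itself costs another
`2`, giving `14`. -/
theorem modularReal_add_le (h : T.IsValid) (a b : ℝ) :
    T.modularReal (a + b) ≤ 14 * (T.modularReal a + T.modularReal b) := by
  have hν := h.isLevyMeasure
  have hVa := hν.integrable_truncVec_smul_sub a
  have hVb := hν.integrable_truncVec_smul_sub b
  have hVab := hν.integrable_truncVec_smul_sub (a + b)
  have hqa := hν.integrable_capSqReal_smul a
  have hqb := hν.integrable_capSqReal_smul b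
  have hqab := hν.integrable_capSqReal_smul (a + b)
  have hdecomp : T.scaledDrift (a + b) = T.scaledDrift a + T.scaledDrift b
      + ∫ x, (truncVec ((a + b) • x) - truncVec (a • x) - truncVec (b • x)) ∂T.levy := by
    have : ∀ x : ι → ℝ, truncVec ((a + b) • x) - truncVec (a • x) - truncVec (b • x)
        = (truncVec ((a + b) • x) - (a + b) • truncVec x) - (truncVec (a • x) - a • truncVec x)
          - (truncVec (b • x) - b • truncVec x) := fun x => by
      rw [add_smul a b (truncVec x)]; abel
    simp_rw [this]
    have h1 : Integrable (fun x => truncVec ((a + b) • x) - (a + b) • truncVec x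
      - (truncVec (a • x) - a • truncVec x)) T.levy := hVab.sub hVa
    rw [integral_sub h1 hVb, integral_sub hVab hVa]
    simp only [scaledDrift, add_smul]
    abel
  have hrem : ‖∫ x, (truncVec ((a + b) • x) - truncVec (a • x) - truncVec (b • x)) ∂T.levy‖
      ≤ 12 * ((∫ x, capSqReal (a • x) ∂T.levy) + ∫ x, capSqReal (b • x) ∂T.levy) := by
    rw [← integral_add hqa hqb, ← integral_const_mul]
    exact norm_integral_le_of_norm_le ((hqa.add hqb).const_mul _)
      (ae_of_all _ fun x => norm_truncVec_add_smul_sub_le a b x)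
  have hd : ‖T.scaledDrift (a + b)‖ ≤ ‖T.scaledDrift a‖ + ‖T.scaledDrift b‖
      + 12 * ((∫ x, capSqReal (a • x) ∂T.levy) + ∫ x, capSqReal (b • x) ∂T.levy) := by
    rw [hdecomp]
    exact (norm_add_le _ _).trans (add_le_add (norm_add_le _ _) hrem)
  have hq : ∫ x, capSqReal ((a + b) • x) ∂T.levy
      ≤ 2 * ((∫ x, capSqReal (a • x) ∂T.levy) + ∫ x, capSqReal (b • x) ∂T.levy) := by
    rw [← integral_add hqa hqb, ← integral_const_mul]
    refine integral_mono hqab ((hqa.add hqb).const_mul _) fun x => ?_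
    simp only [add_smul]
    exact capSqReal_add_le _ _
  have ht := h.trace_nonneg
  have htr : (a + b) ^ 2 * T.cov.trace ≤ 2 * (a ^ 2 * T.cov.trace + b ^ 2 * T.cov.trace) := by
    nlinarith [mul_nonneg (sq_nonneg (a - b)) ht]
  have h1 := mul_nonneg (sq_nonneg a) ht
  have h2 := mul_nonneg (sq_nonneg b) ht
  have h3 : 0 ≤ ∫ x, capSqReal (a • x) ∂T.levy := integral_nonneg fun x => capSqReal_nonneg _
  have h4 : 0 ≤ ∫ x, capSqReal (b • x) ∂T.levy := integral_nonneg fun x => capSqReal_nonneg _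
  have h5 := norm_nonneg (T.scaledDrift a)
  have h6 := norm_nonneg (T.scaledDrift b)
  unfold modularReal
  linarith

theorem measurable_scaledDrift (h : T.IsValid) : Measurable T.scaledDrift := by
  have := h.isLevyMeasure.sigmaFinite
  have h1 : StronglyMeasurable fun p : ℝ × (ι → ℝ) =>
      truncVec (p.1 • p.2) - p.1 • truncVec p.2 := continuous_truncVec_smul_sub.stronglyMeasurable
  have h2 : StronglyMeasurable fun r : ℝ =>
      ∫ x, (truncVec (r • x) - r • truncVec x) ∂T.levy := h1.integral_prod_right
  exact (measurable_id.smul_const T.drift).add h2.measurable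

theorem measurable_modularReal (h : T.IsValid) : Measurable T.modularReal := by
  have := h.isLevyMeasure.sigmaFinite
  have h1 : StronglyMeasurable fun p : ℝ × (ι → ℝ) => capSqReal (p.1 • p.2) :=
    (continuous_capSqReal.comp continuous_smul).stronglyMeasurable
  have h2 : StronglyMeasurable fun r : ℝ => ∫ x, capSqReal (r • x) ∂T.levy :=
    h1.integral_prod_right
  exact ((measurable_scaledDrift h).norm.add (by fun_prop)).add h2.measurable

theorem IntegrableFor.integrable_capSqReal {f : ℝ → ℝ} (hf : T.IntegrableFor f)
    (h : T.IsValid) :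
    Integrable (fun p : ℝ × (ι → ℝ) => capSqReal (f p.1 • p.2)) (volume.prod T.levy) := by
  have := h.isLevyMeasure.sigmaFinite
  have hm : Measurable fun p : ℝ × (ι → ℝ) => f p.1 • p.2 :=
    (hf.measurable.comp measurable_fst).smul measurable_snd
  refine ⟨(continuous_capSqReal.measurable.comp hm).aestronglyMeasurable, ?_⟩
  rw [hasFiniteIntegral_iff_ofReal (ae_of_all _ fun _ => capSqReal_nonneg _),
    lintegral_prod (fun p : ℝ × (ι → ℝ) => ENNReal.ofReal (capSqReal (f p.1 • p.2)))
      (continuous_capSqReal.measurable.comp hm).ennreal_ofReal.aemeasurable]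
  exact hf.levy

theorem IntegrableFor.integrable_modularReal {f : ℝ → ℝ} (hf : T.IntegrableFor f)
    (h : T.IsValid) : Integrable fun s => T.modularReal (f s) := by
  have := h.isLevyMeasure.sigmaFinite
  refine (hf.drift.norm.add ?_).add (hf.integrable_capSqReal h).integral_prod_left
  have : (fun s => f s ^ 2 * T.cov.trace) = fun s => ∑ i, f s ^ 2 * T.cov i i := by
    ext s; rw [Matrix.trace, Finset.mul_sum]; rfl
  rw [this]
  exact integrable_finsetSum _ fun i _ => hf.cov i i

theorem IntegrableFor.integrable_exponent_smul {f : ℝ → ℝ} (hf : T.IntegrableFor f)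
    (h : T.IsValid) (θ : ι → ℝ) : Integrable fun s => T.exponent (f s • θ) :=
  ((hf.integrable_modularReal h).const_mul (levyKernelBound θ)).mono'
    ((continuous_exponent h).measurable.comp
      (hf.measurable.smul_const θ)).aestronglyMeasurable
    (ae_of_all _ fun s => norm_exponent_smul_le h (f s) θ)

end CharTriplet

end Exponent

/-! ### The triplet of a stochastic integral -/

section IntegralTriplet

variable {ι : Type*} [Fintype ι] {T : CharTriplet ι} {f : ℝ → ℝ}

theorem measurable_scaling {κ : Type*} (hf : Measurable f) :
    Measurable fun p : ℝ × (κ → ℝ) => f p.1 • p.2 :=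
  measurable_pi_lambda _ fun i =>
    (hf.comp measurable_fst).mul ((measurable_pi_apply i).comp measurable_snd)

theorem scaledImage_apply {κ : Type*} (hf : Measurable f) (S : Set ℝ) (ν : Measure (κ → ℝ))
    [SFinite ν] {A : Set (κ → ℝ)} (hA : MeasurableSet A) :
    scaledImage f S ν A = ∫⁻ s in S, ν {x | f s • x ∈ A} := by
  rw [scaledImage, Measure.map_apply (measurable_scaling hf) hA,
    Measure.prod_apply (measurable_scaling hf hA)]
  rfl

theorem lintegral_scaledImage {κ : Type*} (hf : Measurable f) (S : Set ℝ) (ν : Measure (κ → ℝ))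
    [SFinite ν] {g : (κ → ℝ) → ℝ≥0∞} (hg : Measurable g) :
    ∫⁻ x, g x ∂scaledImage f S ν = ∫⁻ s in S, ∫⁻ x, g (f s • x) ∂ν := by
  rw [scaledImage, lintegral_map hg (measurable_scaling hf),
    lintegral_prod (fun p : ℝ × (κ → ℝ) => g (f p.1 • p.2))
      (hg.comp (measurable_scaling hf)).aemeasurable]

theorem integralTriplet_isValid (h : T.IsValid) (hf : T.IntegrableFor f) :
    (integralTriplet f T).IsValid := by
  have := h.isLevyMeasure.sigmaFinite
  refine ⟨posSemidef_of_quadForm_nonneg (fun i j => ?_) fun θ => ?_, ?_, ?_⟩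
  · have := h.cov_posSemidef.isHermitian.apply i j
    simp only [star_trivial] at this
    simp [integralTriplet, this]
  · have : ∑ i, ∑ j, θ i * (integralTriplet f T).cov i j * θ j
        = ∫ s, ∑ i, ∑ j, θ i * (f s ^ 2 * T.cov i j) * θ j := by
      rw [integral_finsetSum _ fun i _ => integrable_finsetSum _ fun j _ =>
        ((hf.cov i j).const_mul _).mul_const _]
      refine Finset.sum_congr rfl fun i _ => ?_
      rw [integral_finsetSum _ fun j _ => ((hf.cov i j).const_mul _).mul_const _]
      refine Finset.sum_congr rfl fun j _ => ?_
      rw [integral_mul_const, integral_const_mul]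
      rfl
    rw [this]
    refine integral_nonneg fun s => ?_
    have h1 : ∑ i, ∑ j, θ i * (f s ^ 2 * T.cov i j) * θ j
        = f s ^ 2 * ∑ i, ∑ j, θ i * T.cov i j * θ j := by
      simp only [Finset.mul_sum]
      exact Finset.sum_congr rfl fun i _ => Finset.sum_congr rfl fun j _ => by ring
    simp only [h1]
    exact mul_nonneg (sq_nonneg _) (quadForm_nonneg h.cov_posSemidef θ)
  · simp [integralTriplet]
  · refine (lintegral_mono' Measure.restrict_le_self le_rfl).trans_lt ?_
    rw [lintegral_scaledImage hf.measurable _ _ measurable_capSq, Measure.restrict_univ]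
    exact hf.levy

/-- Integrate `exponent_smul` over `s` term by term, with Fubini for the jumps. Removing the mass at
the origin is harmless because the kernel vanishes there. -/
theorem exponent_integralTriplet (h : T.IsValid) (hf : T.IntegrableFor f) (θ : ι → ℝ) :
    (integralTriplet f T).exponent θ = ∫ s, T.exponent (f s • θ) := by
  have := h.isLevyMeasure.sigmaFinite
  have hK : Integrable (fun p : ℝ × (ι → ℝ) => levyKernel θ (f p.1 • p.2))
      (volume.prod T.levy) :=
    ((hf.integrable_capSqReal h).const_mul (levyKernelBound θ)).mono'
      ((continuous_levyKernel_right θ).measurable.comp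
        (measurable_scaling hf.measurable)).aestronglyMeasurable
      (ae_of_all _ fun p => norm_levyKernel_le θ _)
  have hlevy : ∫ x, levyKernel θ x ∂(integralTriplet f T).levy
      = ∫ s, ∫ x, levyKernel θ (f s • x) ∂T.levy := by
    have h0 : ∫ x, levyKernel θ x ∂(integralTriplet f T).levy
        = ∫ x, levyKernel θ x ∂scaledImage f Set.univ T.levy := by
      refine setIntegral_eq_integral_of_forall_compl_eq_zero fun x hx => ?_
      have : x = 0 := by simpa using hx
      rw [this, levyKernel_zero_right]
    rw [h0, scaledImage, integral_map (measurable_scaling hf.measurable).aemeasurable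
      (continuous_levyKernel_right θ).aestronglyMeasurable, Measure.restrict_univ,
      integral_prod _ hK]
  have hdrift : ∑ i, θ i * (integralTriplet f T).drift i
      = ∫ s, dotCLM θ (T.scaledDrift (f s)) := by
    rw [ContinuousLinearMap.integral_comp_comm _ hf.drift, dotCLM_apply]
    rfl
  have hQint : Integrable fun s => f s ^ 2 * ∑ i, ∑ j, θ i * T.cov i j * θ j := by
    simp only [Finset.mul_sum]
    refine integrable_finsetSum _ fun i _ => integrable_finsetSum _ fun j _ => ?_
    refine (((hf.cov i j).const_mul (θ i)).mul_const (θ j)).congr (ae_of_all _ fun s => ?_)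
    simp only
    ring
  have hcov : ∑ i, ∑ j, θ i * (integralTriplet f T).cov i j * θ j
      = ∫ s, f s ^ 2 * ∑ i, ∑ j, θ i * T.cov i j * θ j := by
    have h1 : ∀ s, f s ^ 2 * ∑ i, ∑ j, θ i * T.cov i j * θ j
        = ∑ i, ∑ j, θ i * (f s ^ 2 * T.cov i j) * θ j := fun s => by
      simp only [Finset.mul_sum]
      exact Finset.sum_congr rfl fun i _ => Finset.sum_congr rfl fun j _ => by ring
    simp_rw [h1]
    rw [integral_finsetSum _ fun i _ => integrable_finsetSum _ fun j _ =>
      ((hf.cov i j).const_mul _).mul_const _]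
    refine Finset.sum_congr rfl fun i _ => ?_
    rw [integral_finsetSum _ fun j _ => ((hf.cov i j).const_mul _).mul_const _]
    refine Finset.sum_congr rfl fun j _ => ?_
    rw [integral_mul_const, integral_const_mul]
    rfl
  have hdint : Integrable fun s => dotCLM θ (T.scaledDrift (f s)) :=
    (dotCLM θ).integrable_comp hf.drift
  have hdint' : Integrable fun s =>
      Complex.I * ((∑ i, θ i * T.scaledDrift (f s) i : ℝ) : ℂ) := by
    simp only [dotCLM_apply] at hdint
    exact (integrable_complexOfReal hdint).const_mul _
  simp_rw [CharTriplet.exponent_smul h]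
  rw [integral_add ?_ hK.integral_prod_left, integral_sub ?_ ?_, integral_const_mul,
    integral_complex_ofReal, integral_complex_ofReal, integral_const_mul,
    CharTriplet.exponent_eq, hlevy, hdrift, hcov]
  · simp only [dotCLM_apply]
  · exact hdint'
  · exact integrable_complexOfReal (hQint.const_mul _)
  · exact hdint'.sub (integrable_complexOfReal (hQint.const_mul _))

end IntegralTriplet

/-! ### Convergence of integrals of exponents -/

section Convergence

/-- Dominated convergence with a moving majorant `d k + G`: the truncated difference with `d k` is
dominated by `G`, and what was subtracted tends to zero in `L¹`. -/
theorem tendsto_lintegral_enorm_sub_of_le {α E : Type*} [MeasurableSpace α] {μ : Measure α}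
    [NormedAddCommGroup E] [MeasurableSpace E] [BorelSpace E] [SecondCountableTopology E]
    {F : ℕ → α → E} {F₀ : α → E} {d : ℕ → α → ℝ≥0∞} {G : α → ℝ≥0∞}
    (hF : ∀ k, Measurable (F k)) (hF₀ : Measurable F₀) (hd : ∀ k, Measurable (d k))
    (hle : ∀ k x, ‖F k x - F₀ x‖ₑ ≤ d k x + G x) (hG : ∫⁻ x, G x ∂μ ≠ ∞)
    (hd0 : Tendsto (fun k => ∫⁻ x, d k x ∂μ) atTop (𝓝 0))
    (hlim : ∀ᵐ x ∂μ, Tendsto (fun k => F k x) atTop (𝓝 (F₀ x))) :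
    Tendsto (fun k => ∫⁻ x, ‖F k x - F₀ x‖ₑ ∂μ) atTop (𝓝 0) := by
  have hm : ∀ k, Measurable fun x => ‖F k x - F₀ x‖ₑ := fun k => ((hF k).sub hF₀).enorm
  have h1 : Tendsto (fun k => ∫⁻ x, (‖F k x - F₀ x‖ₑ - d k x) ∂μ) atTop (𝓝 0) := by
    have := tendsto_lintegral_of_dominated_convergence (μ := μ) (f := fun _ => 0) G
      (F := fun k x => ‖F k x - F₀ x‖ₑ - d k x) (fun k => (hm k).sub (hd k))
      (fun k => ae_of_all _ fun x => tsub_le_iff_left.2 (hle k x)) hG ?_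
    · simpa using this
    · filter_upwards [hlim] with x hx
      have h0 : Tendsto (fun k => ‖F k x - F₀ x‖ₑ) atTop (𝓝 0) := by
        have := (hx.sub_const (F₀ x)).enorm
        simpa using this
      exact tendsto_of_tendsto_of_tendsto_of_le_of_le tendsto_const_nhds h0
        (fun _ => zero_le) fun _ => tsub_le_self
  have h2 := h1.add hd0
  rw [add_zero] at h2
  refine tendsto_of_tendsto_of_tendsto_of_le_of_le tendsto_const_nhds h2
    (fun _ => zero_le) fun k => ?_
  simp only
  rw [← lintegral_add_right _ (hd k)]
  exact lintegral_mono fun x => le_tsub_add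

/-- Quasi-subadditivity bounds the difference of exponents by `14` modulars of `g k - f`, which
vanish in `L¹`, plus `15 = 14 + 1` modulars of `f`, which are integrable. -/
theorem CharTriplet.tendsto_integral_exponent_smul {ι : Type*} [Fintype ι] {T : CharTriplet ι}
    (h : T.IsValid) {f : ℝ → ℝ} (hf : T.IntegrableFor f) {g : ℕ → ℝ → ℝ}
    (hg : ∀ k, Measurable (g k)) (hae : ∀ᵐ s, Tendsto (fun k => g k s) atTop (𝓝 (f s)))
    (hmod : Tendsto (fun k => ∫⁻ s, T.modular (g k s - f s)) atTop (𝓝 0)) (θ : ι → ℝ)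
    (hint : ∀ k, Integrable fun s => T.exponent (g k s • θ)) :
    Tendsto (fun k => ∫ s, T.exponent (g k s • θ)) atTop
      (𝓝 (∫ s, T.exponent (f s • θ))) := by
  have hc := levyKernelBound_nonneg θ
  have hψ := (CharTriplet.continuous_exponent h).measurable
  have hmm : ∀ k, Measurable fun s => T.modularReal (g k s - f s) := fun k =>
    (CharTriplet.measurable_modularReal h).comp ((hg k).sub hf.measurable)
  refine tendsto_integral_of_L1 _ (hf.integrable_exponent_smul h θ).1 (.of_forall hint) ?_
  refine tendsto_lintegral_enorm_sub_of_le
    (d := fun k s => ENNReal.ofReal (levyKernelBound θ * 14) *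
      ENNReal.ofReal (T.modularReal (g k s - f s)))
    (G := fun s => ENNReal.ofReal (levyKernelBound θ * 15 * T.modularReal (f s)))
    (fun k => hψ.comp ((hg k).smul_const θ)) (hψ.comp (hf.measurable.smul_const θ))
    (fun k => (hmm k).ennreal_ofReal.const_mul _) (fun k s => ?_) ?_ ?_ ?_
  · have h1 := CharTriplet.modularReal_nonneg h (g k s - f s)
    have h2 := CharTriplet.modularReal_nonneg h (f s)
    rw [← ENNReal.ofReal_mul (by positivity), ← ENNReal.ofReal_add (by positivity)
      (by positivity), ← ofReal_norm]
    refine ENNReal.ofReal_le_ofReal ((norm_sub_le _ _).trans ?_)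
    have h3 := CharTriplet.norm_exponent_smul_le h (g k s) θ
    have h4 := CharTriplet.norm_exponent_smul_le h (f s) θ
    have h5 := CharTriplet.modularReal_add_le h (g k s - f s) (f s)
    rw [sub_add_cancel] at h5
    nlinarith [mul_le_mul_of_nonneg_left h5 hc]
  · have := ((hf.integrable_modularReal h).const_mul (levyKernelBound θ * 15))
    exact this.lintegral_lt_top.ne
  · simp_rw [CharTriplet.modular_eq_ofReal h] at hmod
    have := ENNReal.Tendsto.const_mul (a := ENNReal.ofReal (levyKernelBound θ * 14)) hmod
      (Or.inr ENNReal.ofReal_ne_top)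
    rw [mul_zero] at this
    refine this.congr fun k => ?_
    rw [lintegral_const_mul _ (hmm k).ennreal_ofReal]
  · filter_upwards [hae] with s hs
    exact ((CharTriplet.continuous_exponent h).tendsto _).comp (hs.smul_const θ)

end Convergence

/-! ### Existence of infinitely divisible laws with a given triplet -/

section Existence

variable {ι : Type*} [Fintype ι]

/-- Compound Poisson laws. -/
theorem exists_charFunPi_compoundPoisson (m : Measure (ι → ℝ)) [IsFiniteMeasure m] :
    ∃ ρ : Measure (ι → ℝ), IsProbabilityMeasure ρ ∧
      ∀ θ, charFunPi ρ θ = Complex.exp (charFunPi m θ - (m.real Set.univ : ℂ)) := by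
  set c := m.real Set.univ with hc
  have hc0 : 0 ≤ c := measureReal_nonneg
  obtain ⟨N, hN⟩ := exists_nat_ge c
  -- The shift makes `k n` positive and at least the total mass `c`, so that `1 - c / k n` is a
  -- legitimate weight.
  let k : ℕ → ℕ := fun n => n + (N + 1)
  have hk : ∀ n, c ≤ k n := fun n => by simp only [k]; push_cast; linarith [n.cast_nonneg (α := ℝ)]
  have hk0 : ∀ n, (0 : ℝ) < k n := fun n => by simp only [k]; positivity
  let b : ℕ → Measure (ι → ℝ) := fun n =>
    ENNReal.ofReal (1 - c / k n) • Measure.dirac 0 + ENNReal.ofReal (1 / k n) • m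
  have hb : ∀ n, IsProbabilityMeasure (b n) := by
    intro n
    constructor
    have h1 : 0 ≤ 1 - c / k n := sub_nonneg.2 ((div_le_one (hk0 n)).2 (hk n))
    have h2 : m Set.univ = ENNReal.ofReal c := by rw [hc, ofReal_measureReal]
    simp only [b, Measure.add_apply, Measure.smul_apply, measure_univ, smul_eq_mul, mul_one, h2]
    rw [← ENNReal.ofReal_mul (by positivity), ← ENNReal.ofReal_add h1 (by positivity)]
    rw [show 1 - c / k n + 1 / k n * c = 1 by ring, ENNReal.ofReal_one]
  have hbc : ∀ n θ, charFunPi (b n) θ = 1 + (charFunPi m θ - (c : ℂ)) / (k n : ℂ) := by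
    intro n θ
    have h1 : 0 ≤ 1 - c / k n := sub_nonneg.2 ((div_le_one (hk0 n)).2 (hk n))
    have hi : ∀ (μ : Measure (ι → ℝ)) [IsFiniteMeasure μ], Integrable
        (fun x => Complex.exp (Complex.I * ((∑ i, θ i * x i : ℝ) : ℂ))) μ := fun μ _ =>
      Integrable.of_bound (C := 1) (Continuous.aestronglyMeasurable (by fun_prop))
        (ae_of_all _ fun x => by rw [mul_comm, Complex.norm_exp_ofReal_mul_I])
    have h2 := charFunPi_dirac (0 : ι → ℝ) θ
    rw [charFunPi] at h2 ⊢
    simp only [b]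
    rw [integral_add_measure ((hi _).smul_measure ENNReal.ofReal_ne_top)
      ((hi _).smul_measure ENNReal.ofReal_ne_top), integral_smul_measure, integral_smul_measure,
      h2, ENNReal.toReal_ofReal h1, ENNReal.toReal_ofReal (by positivity), ← charFunPi]
    have := hk0 n
    simp only [Complex.real_smul]
    push_cast
    simp
    ring
  -- Convolution powers of `b n`: their characteristic functions have the form `(1 + z/k)^k` and
  -- tend to `exp z`.
  let μ : ℕ → Measure (ι → ℝ) := fun n =>
    (Measure.pi fun _ : Fin (k n) => b n).map fun x => ∑ i, x i
  have hμ : ∀ n, IsProbabilityMeasure (μ n) := fun n =>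
    Measure.isProbabilityMeasure_map (by fun_prop)
  refine exists_charFunPi_eq_of_tendsto μ _ ?_ fun θ => ?_
  · exact ((Complex.continuous_exp.comp
      ((continuous_charFunPi m).sub continuous_const))).continuousAt
  · simp only [μ, charFunPi_map_sum_pi, hbc]
    exact (Complex.tendsto_one_add_div_pow_exp _).comp (tendsto_add_atTop_nat (N + 1))

/-- Gaussian laws. -/
theorem exists_charFunPi_gaussian {B : Matrix ι ι ℝ} (hB : B.PosSemidef) :
    ∃ ρ : Measure (ι → ℝ), IsProbabilityMeasure ρ ∧
      ∀ θ, charFunPi ρ θ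
        = Complex.exp (-((1 / 2 * ∑ i, ∑ j, θ i * B i j * θ j : ℝ) : ℂ)) := by
  classical
  refine ⟨(multivariateGaussian 0 B).map WithLp.ofLp,
    Measure.isProbabilityMeasure_map (by fun_prop), fun θ => ?_⟩
  rw [charFunPi_map_ofLp, charFun_multivariateGaussian hB, quadForm_eq_dotProduct]
  simp only [inner_zero_right, Complex.ofReal_zero, zero_mul, zero_sub, star_trivial]
  congr 2
  push_cast
  ring

/-- Infinitely divisible laws without Gaussian part and drift. -/
theorem exists_charFunPi_levyKernel {ν : Measure (ι → ℝ)} (hν : IsLevyMeasure ν) :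
    ∃ ρ : Measure (ι → ℝ), IsProbabilityMeasure ρ ∧
      ∀ θ, charFunPi ρ θ = Complex.exp (∫ x, levyKernel θ x ∂ν) := by
  -- Small jumps are cut off, leaving a finite measure to which the compound Poisson construction
  -- applies.
  let S : ℕ → Set (ι → ℝ) := fun n => {x | 1 / ((n : ℝ) + 1) ≤ capSqReal x}
  have hSm : ∀ n, MeasurableSet (S n) := fun n =>
    measurableSet_le measurable_const continuous_capSqReal.measurable
  have hSfin : ∀ n, IsFiniteMeasure (ν.restrict (S n)) := fun n => by
    constructor
    rw [Measure.restrict_apply_univ]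
    exact hν.integrable_capSqReal.measure_ge_lt_top (by positivity)
  have hlaw : ∀ n, ∃ ρ : Measure (ι → ℝ), IsProbabilityMeasure ρ ∧
      ∀ θ, charFunPi ρ θ = Complex.exp (∫ x in S n, levyKernel θ x ∂ν) := by
    intro n
    obtain ⟨ρ, hρ, hρc⟩ := exists_charFunPi_compoundPoisson (ν.restrict (S n))
    have hτ : Integrable truncVec (ν.restrict (S n)) :=
      Integrable.of_bound (C := 1) continuous_truncVec.aestronglyMeasurable
        (ae_of_all _ fun x => (pi_norm_le_iff_of_nonneg zero_le_one).2 fun i =>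
          abs_trunc_le_one _)
    -- This deterministic shift supplies the compensator in the kernel.
    let a : ι → ℝ := -∫ x in S n, truncVec x ∂ν
    refine ⟨ρ ∗ Measure.dirac a, inferInstance, fun θ => ?_⟩
    rw [charFunPi_conv, hρc, charFunPi_dirac, ← Complex.exp_add]
    congr 1
    have h1 : ∑ i, θ i * a i = -∫ x in S n, dotCLM θ (truncVec x) ∂ν := by
      rw [ContinuousLinearMap.integral_comp_comm _ hτ, ← map_neg, dotCLM_apply]
    have hexp : Integrable (fun x => Complex.exp (Complex.I * ((∑ i, θ i * x i : ℝ) : ℂ)))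
        (ν.restrict (S n)) :=
      Integrable.of_bound (C := 1) (Continuous.aestronglyMeasurable (by fun_prop))
        (ae_of_all _ fun x => by rw [mul_comm, Complex.norm_exp_ofReal_mul_I])
    have hd : Integrable (fun x => ((dotCLM θ (truncVec x) : ℝ) : ℂ)) (ν.restrict (S n)) :=
      integrable_complexOfReal ((dotCLM θ).integrable_comp hτ)
    have h2 : ∫ x in S n, levyKernel θ x ∂ν
        = charFunPi (ν.restrict (S n)) θ - ((ν.restrict (S n)).real Set.univ : ℂ)
          - Complex.I * ((∫ x in S n, dotCLM θ (truncVec x) ∂ν : ℝ) : ℂ) := by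
      have : ∀ x, levyKernel θ x = Complex.exp (Complex.I * ((∑ i, θ i * x i : ℝ) : ℂ)) - 1
          - Complex.I * ((dotCLM θ (truncVec x) : ℝ) : ℂ) := fun x => by
        rw [dotCLM_apply, levyKernel]
      simp_rw [this]
      have h3 : Integrable (fun x => Complex.exp (Complex.I * ((∑ i, θ i * x i : ℝ) : ℂ)) - 1)
        (ν.restrict (S n)) := hexp.sub (integrable_const 1)
      rw [integral_sub h3 (hd.const_mul _), integral_sub hexp (integrable_const 1),
        integral_const_mul, integral_complex_ofReal, integral_const]
      simp [charFunPi]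
    rw [h2, h1]
    push_cast
    ring
  choose ρ hρ hρc using hlaw
  refine exists_charFunPi_eq_of_tendsto ρ _ ?_ fun θ => ?_
  · let T : CharTriplet ι := ⟨0, 0, ν⟩
    have hT : T.IsValid := ⟨Matrix.PosSemidef.zero, hν⟩
    have : (fun θ => Complex.exp (∫ x, levyKernel θ x ∂ν))
        = fun θ => Complex.exp (T.exponent θ) := by
      ext θ
      rw [CharTriplet.exponent_eq]
      simp [T]
    rw [this]
    exact (Complex.continuous_exp.comp (CharTriplet.continuous_exponent hT)).continuousAt
  · simp only [hρc]
    refine (Complex.continuous_exp.tendsto _).comp ?_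
    have hmono : Monotone S := by
      intro m n hmn x hx
      have hmn' : (m : ℝ) + 1 ≤ n + 1 := by gcongr
      exact (one_div_le_one_div_of_le (by positivity) hmn').trans hx
    have := tendsto_setIntegral_of_monotone (f := levyKernel θ) hSm hmono
      (hν.integrable_levyKernel θ).integrableOn
    rwa [setIntegral_eq_integral_of_forall_compl_eq_zero] at this
    intro x hx
    have h0 : capSqReal x ≤ 0 := by
      by_contra hpos
      obtain ⟨n, hn⟩ := exists_nat_one_div_lt (not_le.1 hpos)
      exact hx (Set.mem_iUnion.2 ⟨n, hn.le⟩)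
    have h1 : capSqReal x = 0 := le_antisymm h0 (capSqReal_nonneg x)
    have h2 := norm_levyKernel_le θ x
    rw [h1, mul_zero] at h2
    exact norm_le_zero_iff.1 h2

/-- Every valid triplet is the characteristic triplet of an infinitely divisible law. -/
theorem CharTriplet.IsValid.exists_hasTriplet {T : CharTriplet ι} (h : T.IsValid) :
    ∃ μ, HasTriplet μ T := by
  obtain ⟨ρ₁, h₁, hc₁⟩ := exists_charFunPi_gaussian h.cov_posSemidef
  obtain ⟨ρ₂, h₂, hc₂⟩ := exists_charFunPi_levyKernel h.isLevyMeasure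
  refine ⟨(Measure.dirac T.drift ∗ ρ₁) ∗ ρ₂, inferInstance, h, fun θ => ?_⟩
  change charFunPi _ θ = _
  rw [charFunPi_conv, charFunPi_conv, charFunPi_dirac, hc₁, hc₂, ← Complex.exp_add,
    ← Complex.exp_add, CharTriplet.exponent_eq, sub_eq_add_neg]

theorem HasTriplet.eq {T : CharTriplet ι} {μ ρ : Measure (ι → ℝ)} (hμ : HasTriplet μ T)
    (hρ : HasTriplet ρ T) : μ = ρ := by
  have := hμ.isProbabilityMeasure
  have := hρ.isProbabilityMeasure
  exact ext_of_charFunPi fun θ => (hμ.charFun_eq θ).trans (hρ.charFun_eq θ).symm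

end Existence

/-! ### Lévy processes and their elementary integrals -/

section RootsOfExponentials

/-- A continuous function on a connected space whose values are `n`-th roots of unity is
constant. -/
theorem eq_one_of_continuous_of_pow_eq_one {E : Type*} [TopologicalSpace E] [PreconnectedSpace E]
    {u : E → ℂ} (hu : Continuous u) {n : ℕ} (hn : n ≠ 0) (hpow : ∀ x, u x ^ n = 1) {x₀ : E}
    (h₀ : u x₀ = 1) (x : E) : u x = 1 := by
  have hfin : {z : ℂ | z ^ n = 1}.Finite := by
    refine (Polynomial.nthRootsFinset n (1 : ℂ)).finite_toSet.subset fun z hz => ?_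
    exact (Polynomial.mem_nthRootsFinset (Nat.pos_of_ne_zero hn) 1).2 hz
  rw [← h₀]
  exact isPreconnected_univ.constant_of_mapsTo hfin.isDiscrete hu.continuousOn
    (fun y _ => hpow y) (Set.mem_univ _) (Set.mem_univ _)

/-- Continuous `n`-th roots of exponentials are unique. -/
theorem eq_exp_div_of_pow_eq_exp {E : Type*} [TopologicalSpace E] [PreconnectedSpace E]
    {φ ψ : E → ℂ} (hφ : Continuous φ) (hψ : Continuous ψ) {n : ℕ} (hn : n ≠ 0)
    (hpow : ∀ x, φ x ^ n = Complex.exp (ψ x)) {x₀ : E} (hφ₀ : φ x₀ = 1) (hψ₀ : ψ x₀ = 0) (x : E) :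
    φ x = Complex.exp (ψ x / n) := by
  have hn' : (n : ℂ) ≠ 0 := Nat.cast_ne_zero.2 hn
  have hexp : ∀ y, Complex.exp (-(ψ y / n)) ^ n = Complex.exp (-ψ y) := fun y => by
    rw [← Complex.exp_nat_mul]
    congr 1
    field_simp
  -- The quotient of the two candidate roots is continuous with values in the `n`-th roots of unity.
  have := eq_one_of_continuous_of_pow_eq_one (u := fun y => φ y * Complex.exp (-(ψ y / n)))
    (by fun_prop) hn (fun y => by rw [mul_pow, hpow, hexp, ← Complex.exp_add, add_neg_cancel,
      Complex.exp_zero]) (x₀ := x₀) (by simp [hφ₀, hψ₀]) x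
  rw [Complex.exp_neg] at this
  field_simp at this
  exact this

end RootsOfExponentials

section LevyProcess

variable {ι Ω : Type*} [Fintype ι] [MeasurableSpace Ω] {P : Measure Ω}

theorem charFunPi_map {Y : Ω → ι → ℝ} (hY : AEMeasurable Y P) (θ : ι → ℝ) :
    charFunPi (P.map Y) θ
      = ∫ ω, Complex.exp (Complex.I * ((∑ i, θ i * Y ω i : ℝ) : ℂ)) ∂P := by
  rw [charFunPi, integral_map hY (Continuous.aestronglyMeasurable (by fun_prop))]

theorem charFunPi_map_smul {Y : Ω → ι → ℝ} (hY : AEMeasurable Y P) (a : ℝ) (θ : ι → ℝ) :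
    charFunPi (P.map (a • Y)) θ = charFunPi (P.map Y) (a • θ) := by
  rw [charFunPi_map (hY.const_smul a), charFunPi_map hY]
  have : ∀ ω, ∑ i, θ i * (a • Y) ω i = ∑ i, (a • θ) i * Y ω i := fun ω =>
    Finset.sum_congr rfl fun i _ => by simp only [Pi.smul_apply, smul_eq_mul]; ring
  simp_rw [this]

theorem charFunPi_map_add {Y Z : Ω → ι → ℝ} (hY : AEMeasurable Y P) (hZ : AEMeasurable Z P)
    [IsFiniteMeasure P] (h : IndepFun Y Z P) (θ : ι → ℝ) :
    charFunPi (P.map (Y + Z)) θ = charFunPi (P.map Y) θ * charFunPi (P.map Z) θ := by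
  simp only [charFunPi_eq_charFunDual]
  rw [h.charFunDual_map_add_eq_mul hY hZ, Pi.mul_apply]

theorem charFunPi_map_sum {n : ℕ} {Y : Fin n → Ω → ι → ℝ} (hY : ∀ i, AEMeasurable (Y i) P)
    (h : iIndepFun Y P) (θ : ι → ℝ) :
    charFunPi (P.map fun ω => ∑ i, Y i ω) θ = ∏ i, charFunPi (P.map (Y i)) θ := by
  simp only [charFunPi_eq_charFunDual]
  rw [h.charFunDual_map_fun_sum_eq_prod hY, Finset.prod_apply]

/-- Convergence in probability implies convergence of the characteristic functions. -/
theorem tendsto_charFunPi_of_tendstoInMeasure [IsFiniteMeasure P] {Y : ℕ → Ω → ι → ℝ}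
    {Z : Ω → ι → ℝ} (hY : ∀ k, AEMeasurable (Y k) P) (hZ : AEMeasurable Z P)
    (h : TendstoInMeasure P Y atTop Z) (θ : ι → ℝ) :
    Tendsto (fun k => charFunPi (P.map (Y k)) θ) atTop (𝓝 (charFunPi (P.map Z) θ)) := by
  -- Every subsequence has a further subsequence converging almost everywhere, along which dominated
  -- convergence applies.
  refine tendsto_of_subseq_tendsto fun ns hns => ?_
  have h' : TendstoInMeasure P (fun k => Y (ns k)) atTop Z := fun ε hε => (h ε hε).comp hns
  obtain ⟨ms, -, hms⟩ := h'.exists_seq_tendsto_ae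
  refine ⟨ms, ?_⟩
  simp_rw [charFunPi_map (hY _), charFunPi_map hZ]
  have hc : Continuous fun x : ι → ℝ => Complex.exp (Complex.I * ((∑ i, θ i * x i : ℝ) : ℂ)) := by
    fun_prop
  refine tendsto_integral_of_dominated_convergence (fun _ => 1)
    (fun k => (hc.measurable.comp_aemeasurable (hY _)).aestronglyMeasurable)
    (integrable_const _) (fun k => ae_of_all _ fun ω => ?_) ?_
  · rw [mul_comm, Complex.norm_exp_ofReal_mul_I]
  · filter_upwards [hms] with ω hω
    exact (hc.tendsto _).comp hω

namespace IsTwoSidedLevy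

variable [IsProbabilityMeasure P] {L : ℝ → Ω → ι → ℝ} {T : CharTriplet ι}

theorem charFunPi_zero_time (hL : IsTwoSidedLevy P L) (θ : ι → ℝ) :
    charFunPi (P.map (L 0)) θ = 1 := by
  rw [Measure.map_congr (g := fun _ => (0 : ι → ℝ)) hL.zero, Measure.map_const, measure_univ,
    one_smul, charFunPi_dirac]
  simp

theorem charFunPi_add_time (hL : IsTwoSidedLevy P L) {s t : ℝ} (hs : 0 ≤ s) (ht : 0 ≤ t)
    (θ : ι → ℝ) :
    charFunPi (P.map (L (s + t))) θ = charFunPi (P.map (L s)) θ * charFunPi (P.map (L t)) θ := by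
  have hst : s ≤ s + t := le_add_of_nonneg_right ht
  have hind := hL.indep.indepFun_eval_sub hs hst hL.zero
  have h1 := charFunPi_map_add (hL.measurable s).aemeasurable
    ((hL.measurable (s + t)).sub (hL.measurable s)).aemeasurable hind θ
  have h2 := hL.stationary s (s + t) hst
  rw [add_sub_cancel_left] at h2
  rw [add_sub_cancel] at h1
  rw [h1, ← h2]
  rfl

theorem charFunPi_nsmul_time (hL : IsTwoSidedLevy P L) {s : ℝ} (hs : 0 ≤ s) (n : ℕ)
    (θ : ι → ℝ) : charFunPi (P.map (L (n * s))) θ = charFunPi (P.map (L s)) θ ^ n := by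
  induction n with
  | zero => simp [hL.charFunPi_zero_time]
  | succ n ih =>
    have : ((n + 1 : ℕ) : ℝ) * s = n * s + s := by push_cast; ring
    rw [this, hL.charFunPi_add_time (by positivity) hs, ih, pow_succ]

/-- At time `1/n` the `n`-th root is singled out by continuity in `θ` and the value `1` at `θ = 0`.
Powers give nonnegative rational times, and stochastic continuity gives real ones. -/
theorem charFunPi_time (hL : IsTwoSidedLevy P L) (hT : HasTriplet (P.map (L 1)) T) {t : ℝ}
    (ht : 0 ≤ t) (θ : ι → ℝ) :
    charFunPi (P.map (L t)) θ = Complex.exp (t * T.exponent θ) := by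
  have hprob : ∀ t, IsProbabilityMeasure (P.map (L t)) := fun t =>
    Measure.isProbabilityMeasure_map (hL.measurable t).aemeasurable
  have hroot : ∀ n : ℕ, n ≠ 0 → ∀ θ,
      charFunPi (P.map (L (1 / n))) θ = Complex.exp (T.exponent θ / n) := by
    intro n hn
    have hn' : (n : ℝ) ≠ 0 := Nat.cast_ne_zero.2 hn
    refine eq_exp_div_of_pow_eq_exp (continuous_charFunPi _)
      (CharTriplet.continuous_exponent hT.isValid) hn (fun θ => ?_) (charFunPi_zero _)
      (CharTriplet.exponent_zero T)
    rw [← hL.charFunPi_nsmul_time (by positivity), mul_one_div_cancel hn']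
    exact hT.charFun_eq θ
  -- Rational approximations of `t`; the degenerate term `k = 0` is discarded at the end.
  let q : ℕ → ℝ := fun k => (⌊t * k⌋₊ : ℝ) / k
  have hq : Tendsto q atTop (𝓝 t) :=
    (tendsto_nat_floor_mul_div_atTop ht).comp tendsto_natCast_atTop_atTop
  have hqc : ∀ k : ℕ, k ≠ 0 →
      charFunPi (P.map (L (q k))) θ = Complex.exp (q k * T.exponent θ) := by
    intro k hk
    have : q k = (⌊t * k⌋₊ : ℝ) * (1 / k) := by simp only [q]; ring
    rw [this, hL.charFunPi_nsmul_time (by positivity), hroot k hk, ← Complex.exp_nat_mul]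
    congr 1
    push_cast
    ring
  have h1 : Tendsto (fun k => charFunPi (P.map (L (q k))) θ) atTop
      (𝓝 (charFunPi (P.map (L t)) θ)) :=
    tendsto_charFunPi_of_tendstoInMeasure (fun k => (hL.measurable _).aemeasurable)
      (hL.measurable t).aemeasurable (fun ε hε => (hL.stochContinuous t ε hε).comp hq) θ
  have h2 : Tendsto (fun k => Complex.exp (q k * T.exponent θ)) atTop
      (𝓝 (Complex.exp (t * T.exponent θ))) := by
    refine (Complex.continuous_exp.tendsto _).comp (Tendsto.mul_const _ ?_)
    exact (Complex.continuous_ofReal.tendsto t).comp hq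
  refine tendsto_nhds_unique h1 (h2.congr' ?_)
  filter_upwards [eventually_ne_atTop 0] with k hk
  exact (hqc k hk).symm

theorem charFunPi_increment (hL : IsTwoSidedLevy P L) (hT : HasTriplet (P.map (L 1)) T) {s t : ℝ}
    (hst : s ≤ t) (θ : ι → ℝ) :
    charFunPi (P.map fun ω => L t ω - L s ω) θ
      = Complex.exp (((t - s : ℝ) : ℂ) * T.exponent θ) := by
  rw [hL.stationary s t hst, hL.charFunPi_time hT (sub_nonneg.2 hst)]

end IsTwoSidedLevy

namespace StepFn

theorem measurable_eval (g : StepFn) : Measurable g.eval := by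
  unfold eval
  exact Finset.measurable_sum _ fun i _ => measurable_const.indicator measurableSet_Ioc

/-- A function vanishing at zero acts on the values of a step function. -/
theorem comp_eval (g : StepFn) {E : Type*} [AddCommMonoid E] {h : ℝ → E} (h0 : h 0 = 0) (s : ℝ) :
    h (g.eval s) = ∑ i : Fin g.n,
      (Set.Ioc (g.t i.castSucc) (g.t i.succ)).indicator (fun _ => h (g.a i)) s := by
  by_cases hs : ∃ i : Fin g.n, s ∈ Set.Ioc (g.t i.castSucc) (g.t i.succ)
  · obtain ⟨i, hi⟩ := hs
    -- Half-open intervals between ordered knots are disjoint, so only one summand survives.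
    have hne : ∀ j : Fin g.n, j ≠ i → s ∉ Set.Ioc (g.t j.castSucc) (g.t j.succ) := by
      intro j hji hj
      rcases lt_or_gt_of_ne hji with hlt | hlt
      · have : g.t j.succ ≤ g.t i.castSucc := g.mono (by
          rw [Fin.le_def, Fin.val_succ, Fin.val_castSucc]; exact hlt)
        linarith [hj.2, hi.1]
      · have : g.t i.succ ≤ g.t j.castSucc := g.mono (by
          rw [Fin.le_def, Fin.val_succ, Fin.val_castSucc]; exact hlt)
        linarith [hi.2, hj.1]
    rw [eval, Finset.sum_eq_single i, Finset.sum_eq_single i, Set.indicator_of_mem hi,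
      Set.indicator_of_mem hi]
    · exact fun j _ hj => Set.indicator_of_notMem (hne j hj) _
    · simp
    · exact fun j _ hj => Set.indicator_of_notMem (hne j hj) _
    · simp
  · push Not at hs
    rw [eval, Finset.sum_eq_zero fun i _ => Set.indicator_of_notMem (hs i) _,
      Finset.sum_eq_zero fun i _ => Set.indicator_of_notMem (hs i) _, h0]

theorem integrable_comp_eval (g : StepFn) {h : ℝ → ℂ} (h0 : h 0 = 0) :
    Integrable fun s => h (g.eval s) := by
  simp_rw [g.comp_eval h0]
  refine integrable_finsetSum _ fun i _ => ?_
  rw [integrable_indicator_iff measurableSet_Ioc]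
  exact integrableOn_const (by simp)

theorem integral_comp_eval (g : StepFn) {h : ℝ → ℂ} (h0 : h 0 = 0) :
    ∫ s, h (g.eval s) = ∑ i : Fin g.n, ((g.t i.succ - g.t i.castSucc : ℝ) : ℂ) * h (g.a i) := by
  simp_rw [g.comp_eval h0]
  rw [integral_finsetSum]
  · refine Finset.sum_congr rfl fun i _ => ?_
    have : g.t i.castSucc ≤ g.t i.succ := g.mono (Fin.castSucc_le_succ i)
    rw [integral_indicator measurableSet_Ioc, setIntegral_const, Real.volume_real_Ioc_of_le this,
      Complex.real_smul]
  · intro i _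
    rw [integrable_indicator_iff measurableSet_Ioc]
    exact integrableOn_const (by simp)

variable {L : ℝ → Ω → ι → ℝ} {T : CharTriplet ι}

theorem measurable_integral (g : StepFn) (hL : IsTwoSidedLevy P L) :
    Measurable (g.integral L) := by
  unfold StepFn.integral
  exact Finset.measurable_sum _ fun i _ =>
    ((hL.measurable _).sub (hL.measurable _)).const_smul (g.a i)

/-- Independence multiplies the factors `exp((t_{i+1} - t_i) ψ(a_i θ))`, and the sum of their
exponents is the integral of a step function of `s`. -/
theorem charFunPi_integral [IsProbabilityMeasure P] (g : StepFn) (hL : IsTwoSidedLevy P L)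
    (hT : HasTriplet (P.map (L 1)) T) (θ : ι → ℝ) :
    charFunPi (P.map (g.integral L)) θ = Complex.exp (∫ s, T.exponent (g.eval s • θ)) := by
  have hind : iIndepFun (fun (i : Fin g.n) ω =>
      g.a i • (L (g.t i.succ) ω - L (g.t i.castSucc) ω)) P :=
    (hL.indep g.n g.t g.mono).comp (fun i x => g.a i • x) fun i => measurable_const_smul (g.a i)
  have hm : ∀ i : Fin g.n, Measurable fun ω => L (g.t i.succ) ω - L (g.t i.castSucc) ω :=
    fun i => (hL.measurable _).sub (hL.measurable _)
  have h1 := charFunPi_map_sum (fun i => ((hm i).const_smul (g.a i)).aemeasurable) hind θ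
  have h2 := g.integral_comp_eval (h := fun r => T.exponent (r • θ))
    (by simp [CharTriplet.exponent_zero])
  rw [h2, Complex.exp_sum]
  refine h1.trans (Finset.prod_congr rfl fun i _ => ?_)
  rw [charFunPi_map_smul (hm i).aemeasurable,
    hL.charFunPi_increment hT (g.mono (Fin.castSucc_le_succ i))]

end StepFn

/-- The stochastic integral `∫ f dL` has the triplet `integralTriplet f T`. -/
theorem IsLevyIntegral.hasTriplet [IsProbabilityMeasure P] {L : ℝ → Ω → ι → ℝ}
    {T : CharTriplet ι} {f : ℝ → ℝ} {Z : Ω → ι → ℝ} (hL : IsTwoSidedLevy P L)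
    (hT : HasTriplet (P.map (L 1)) T) (hf : T.IntegrableFor f) (hZ : IsLevyIntegral P L T f Z) :
    HasTriplet (P.map Z) (integralTriplet f T) := by
  obtain ⟨hZm, g, hae, hmod, hlim⟩ := hZ
  refine ⟨Measure.isProbabilityMeasure_map hZm, integralTriplet_isValid hT.isValid hf,
    fun θ => ?_⟩
  change charFunPi _ θ = _
  rw [exponent_integralTriplet hT.isValid hf]
  have h1 := tendsto_charFunPi_of_tendstoInMeasure
    (fun k => ((g k).measurable_integral hL).aemeasurable) hZm hlim θ
  have h2 := CharTriplet.tendsto_integral_exponent_smul hT.isValid hf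
    (fun k => (g k).measurable_eval) hae hmod θ
    (fun k => (g k).integrable_comp_eval (h := fun r => T.exponent (r • θ))
      (by simp [CharTriplet.exponent_zero]))
  refine tendsto_nhds_unique h1 (((Complex.continuous_exp.tendsto _).comp h2).congr fun k => ?_)
  exact ((g k).charFunPi_integral hL hT θ).symm

end LevyProcess

/-! ### Systems of triplets induced by a measure on `ℝ^U` -/

section FieldTriplet

variable {U : Type*} {Γ : U → ℝ} {B : U → U → ℝ} {ν : Measure (U → ℝ)}

theorem fieldTriplet_levy_apply (Γ : U → ℝ) (B : U → U → ℝ) (ν : Measure (U → ℝ)) (u : Finset U)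
    {A : Set (u → ℝ)} (hA : MeasurableSet A) (h0 : (0 : u → ℝ) ∉ A) :
    (fieldTriplet Γ B ν u).levy A = ν (u.restrict ⁻¹' A) := by
  have : A ∩ {0}ᶜ = A := by
    rw [Set.inter_eq_left]
    exact fun x hx h => h0 (h ▸ hx)
  rw [fieldTriplet, Measure.restrict_apply hA, this,
    Measure.map_apply (Finset.measurable_restrict u) hA]

theorem lintegral_fieldTriplet_levy (Γ : U → ℝ) (B : U → U → ℝ) (ν : Measure (U → ℝ))
    (u : Finset U) {g : (u → ℝ) → ℝ≥0∞} (hg : Measurable g) (h0 : g 0 = 0) :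
    ∫⁻ x, g x ∂(fieldTriplet Γ B ν u).levy = ∫⁻ x, g (u.restrict x) ∂ν := by
  have : ∀ x, ({0}ᶜ : Set (u → ℝ)).indicator g x = g x := fun x => by
    by_cases hx : x = 0
    · simp [hx, h0]
    · exact Set.indicator_of_mem hx _
  rw [fieldTriplet, ← lintegral_indicator (measurableSet_singleton 0).compl]
  simp_rw [this]
  rw [lintegral_map hg (Finset.measurable_restrict u)]

theorem integral_fieldTriplet_levy {E : Type*} [NormedAddCommGroup E] [NormedSpace ℝ E]
    (Γ : U → ℝ) (B : U → U → ℝ) (ν : Measure (U → ℝ)) (u : Finset U) {g : (u → ℝ) → E}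
    (hg : StronglyMeasurable g) (h0 : g 0 = 0) :
    ∫ x, g x ∂(fieldTriplet Γ B ν u).levy = ∫ x, g (u.restrict x) ∂ν := by
  rw [← integral_map (Finset.measurable_restrict u).aemeasurable hg.aestronglyMeasurable]
  refine setIntegral_eq_integral_of_forall_compl_eq_zero fun x hx => ?_
  have : x = 0 := by simpa using hx
  rw [this, h0]

/-- Extension by zero of a vector indexed by a smaller finite set. -/
noncomputable def extendZero {J I : Finset U} (θ : J → ℝ) : I → ℝ :=
  open scoped Classical in fun i => if h : i.1 ∈ J then θ ⟨i.1, h⟩ else 0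

theorem sum_extendZero_mul {J I : Finset U} (hJI : J ⊆ I) (θ : J → ℝ) (x : I → ℝ) :
    ∑ i, extendZero (I := I) θ i * x i = ∑ j, θ j * x ⟨j.1, hJI j.2⟩ := by
  symm
  refine Fintype.sum_of_injective (fun j : J => (⟨j.1, hJI j.2⟩ : I)) ?_ _ _ ?_ ?_
  · intro a b hab
    exact Subtype.ext (congrArg (fun i : I => i.1) hab)
  · intro i hi
    have : i.1 ∉ J := fun h => hi ⟨⟨i.1, h⟩, rfl⟩
    simp [extendZero, this]
  · intro j
    simp [extendZero]

/-- Both jump parts are integrals over `ℝ^U` of the same function, as coordinates of weight zero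
drop out. This is the compatibility needed for Kolmogorov extension. -/
theorem exponent_fieldTriplet_extendZero {J I : Finset U} (hJI : J ⊆ I) (θ : J → ℝ) :
    (fieldTriplet Γ B ν I).exponent (extendZero θ) = (fieldTriplet Γ B ν J).exponent θ := by
  have h1 : ∑ i, extendZero (I := I) θ i * (fieldTriplet Γ B ν I).drift i
      = ∑ j, θ j * (fieldTriplet Γ B ν J).drift j := sum_extendZero_mul hJI _ _
  have h2 : ∑ i, ∑ j, extendZero (I := I) θ i * (fieldTriplet Γ B ν I).cov i j * extendZero θ j
      = ∑ i, ∑ j, θ i * (fieldTriplet Γ B ν J).cov i j * θ j := by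
    have hr : ∀ i : I, ∑ j : I, extendZero (I := I) θ i * B i j * extendZero θ j
        = extendZero (I := I) θ i * ∑ j : J, θ j * B i j := by
      intro i
      rw [← sum_extendZero_mul hJI θ (fun j : I => B i j), Finset.mul_sum]
      exact Finset.sum_congr rfl fun j _ => by ring
    refine (Finset.sum_congr rfl fun i _ => hr i).trans ?_
    rw [sum_extendZero_mul hJI θ fun i : I => ∑ j : J, θ j * B i j]
    refine Finset.sum_congr rfl fun i _ => ?_
    rw [Finset.mul_sum]
    refine Finset.sum_congr rfl fun j _ => ?_
    simp only [fieldTriplet, Matrix.of_apply]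
    ring
  have h3 : ∀ x : U → ℝ,
      levyKernel (extendZero θ) (I.restrict x) = levyKernel θ (J.restrict x) := by
    intro x
    rw [levyKernel, sum_extendZero_mul hJI, sum_extendZero_mul hJI]
    rfl
  rw [CharTriplet.exponent_eq, CharTriplet.exponent_eq, h1, h2,
    integral_fieldTriplet_levy _ _ _ _ (continuous_levyKernel_right _).stronglyMeasurable
      (levyKernel_zero_right _),
    integral_fieldTriplet_levy _ _ _ _ (continuous_levyKernel_right _).stronglyMeasurable
      (levyKernel_zero_right _)]
  simp_rw [h3]

theorem charFunPi_map_restrict₂ {J I : Finset U} (hJI : J ⊆ I) (μ : Measure (I → ℝ)) (θ : J → ℝ) :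
    charFunPi (μ.map (Finset.restrict₂ (π := fun _ => ℝ) hJI)) θ
      = charFunPi μ (extendZero θ) := by
  rw [charFunPi_map (Finset.measurable_restrict₂ hJI).aemeasurable, charFunPi]
  simp_rw [sum_extendZero_mul hJI]
  rfl

/-- A law on `ℝ^U` is determined by the triplets of its finite-dimensional marginals. -/
theorem eq_of_hasTriplet_map_restrict {T : (u : Finset U) → CharTriplet u}
    {μ μ' : Measure (U → ℝ)} (h : ∀ u : Finset U, HasTriplet (μ.map u.restrict) (T u))
    (h' : ∀ u : Finset U, HasTriplet (μ'.map u.restrict) (T u)) : μ' = μ := by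
  have (u : Finset U) : IsFiniteMeasure (μ.map u.restrict) := by
    have := (h u).isProbabilityMeasure
    infer_instance
  exact IsProjectiveLimit.unique (α := fun _ => ℝ) (P := fun u => μ.map u.restrict)
    (fun u => (h' u).eq (h u)) fun u => rfl

theorem isProbabilityMeasure_of_hasTriplet {T : (u : Finset U) → CharTriplet u}
    {μ : Measure (U → ℝ)} (h : ∀ u : Finset U, HasTriplet (μ.map u.restrict) (T u)) :
    IsProbabilityMeasure μ := by
  have := (h ∅).isProbabilityMeasure
  constructor
  rw [← measure_univ (μ := μ.map (Finset.restrict (π := fun _ : U => ℝ) ∅)),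
    Measure.map_apply (Finset.measurable_restrict ∅) .univ, Set.preimage_univ]

/-- Systems of valid triplets induced by `(Γ, B, ν)` are those of the finite-dimensional
marginals of a law on `ℝ^U`. -/
theorem exists_hasTriplet_map_restrict (h : ∀ u, (fieldTriplet Γ B ν u).IsValid) :
    ∃ μ : Measure (U → ℝ), ∀ u : Finset U,
      HasTriplet (μ.map u.restrict) (fieldTriplet Γ B ν u) := by
  choose P hP using fun u => (h u).exists_hasTriplet
  have hprob := fun u => (hP u).isProbabilityMeasure
  have hproj : IsProjectiveMeasureFamily (α := fun _ => ℝ) P := by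
    intro I J hJI
    have : IsFiniteMeasure ((P I).map (Finset.restrict₂ (π := fun _ => ℝ) hJI)) := inferInstance
    refine ext_of_charFunPi fun θ => ?_
    rw [charFunPi_map_restrict₂ hJI]
    refine ((hP J).charFun_eq θ).trans (Eq.trans ?_ ((hP I).charFun_eq (extendZero θ)).symm)
    rw [exponent_fieldTriplet_extendZero hJI]
  obtain ⟨μ, hμ⟩ := exists_isProjectiveLimit hproj
  exact ⟨μ, fun u => by rw [hμ u]; exact hP u⟩

theorem fieldTriplet_smul_levy (c : ℝ≥0∞) (u : Finset U) (Γ' : U → ℝ) (B' : U → U → ℝ) :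
    (fieldTriplet Γ' B' (c • ν) u).levy = c • (fieldTriplet Γ B ν u).levy := by
  simp only [fieldTriplet, Measure.map_smul, Measure.restrict_smul]

theorem fieldTriplet_smul_isValid {u : Finset U} (h : (fieldTriplet Γ B ν u).IsValid) {c : ℝ}
    (hc : 0 ≤ c) :
    (fieldTriplet (c • Γ) (fun i j => c * B i j) (ENNReal.ofReal c • ν) u).IsValid := by
  refine ⟨?_, ?_, ?_⟩
  · exact h.cov_posSemidef.smul hc
  · rw [fieldTriplet_smul_levy (Γ := Γ) (B := B), Measure.smul_apply, h.isLevyMeasure.zero_null,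
      smul_zero]
  · rw [fieldTriplet_smul_levy (Γ := Γ) (B := B), lintegral_smul_measure]
    exact ENNReal.mul_lt_top ENNReal.ofReal_lt_top h.isLevyMeasure.capSq_lt_top

theorem exponent_fieldTriplet_smul (u : Finset U) {c : ℝ} (hc : 0 ≤ c) (θ : u → ℝ) :
    (fieldTriplet (c • Γ) (fun i j => c * B i j) (ENNReal.ofReal c • ν) u).exponent θ
      = c * (fieldTriplet Γ B ν u).exponent θ := by
  have h1 : ∑ i, θ i * (fieldTriplet (c • Γ) (fun i j => c * B i j)
      (ENNReal.ofReal c • ν) u).drift i = c * ∑ i, θ i * (fieldTriplet Γ B ν u).drift i := by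
    rw [Finset.mul_sum]
    refine Finset.sum_congr rfl fun i _ => ?_
    simp only [fieldTriplet, Finset.restrict, Pi.smul_apply, smul_eq_mul]
    ring
  have h2 : ∑ i, ∑ j, θ i * (fieldTriplet (c • Γ) (fun i j => c * B i j)
      (ENNReal.ofReal c • ν) u).cov i j * θ j
      = c * ∑ i, ∑ j, θ i * (fieldTriplet Γ B ν u).cov i j * θ j := by
    simp only [Finset.mul_sum, fieldTriplet, Matrix.of_apply]
    exact Finset.sum_congr rfl fun i _ => Finset.sum_congr rfl fun j _ => by ring
  rw [CharTriplet.exponent_eq, CharTriplet.exponent_eq, h1, h2,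
    fieldTriplet_smul_levy (Γ := Γ) (B := B), integral_smul_measure, ENNReal.toReal_ofReal hc,
    Complex.real_smul]
  push_cast
  ring

/-- Laws on `ℝ^U` whose finite-dimensional triplets are induced by `(Γ, B, ν)` are infinitely
divisible. -/
theorem isInfDivLaw_of_hasTriplet {μ : Measure (U → ℝ)}
    (h : ∀ u : Finset U, HasTriplet (μ.map u.restrict) (fieldTriplet Γ B ν u)) :
    IsInfDivLaw μ := by
  intro n hn
  have hn' : (n : ℝ) ≠ 0 := Nat.cast_ne_zero.2 (by omega)
  have hc : (0 : ℝ) ≤ (n : ℝ)⁻¹ := by positivity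
  -- The convolution root is the field with triplet `(Γ, B, ν) / n`.
  obtain ⟨ρ, hρ⟩ := exists_hasTriplet_map_restrict
    fun u => fieldTriplet_smul_isValid (h u).isValid hc
  have hρp := isProbabilityMeasure_of_hasTriplet hρ
  refine ⟨ρ, hρp, eq_of_hasTriplet_map_restrict h fun u => ?_⟩
  have hm : Measurable fun x : Fin n → U → ℝ => ∑ i, x i := by fun_prop
  have hmu : Measurable fun x : Fin n → u → ℝ => ∑ i, x i := by fun_prop
  have hr := Finset.measurable_restrict (X := fun _ : U => ℝ) u
  have hmap : ((Measure.pi fun _ : Fin n => ρ).map fun x => ∑ i, x i).map u.restrict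
      = (Measure.pi fun _ : Fin n => ρ.map u.restrict).map fun x => ∑ i, x i := by
    have := (hρ u).isProbabilityMeasure
    rw [← Measure.pi_map_pi fun _ => hr.aemeasurable, Measure.map_map hr hm,
      Measure.map_map hmu (by fun_prop)]
    congr 1
    ext x i
    simp [Finset.restrict]
  refine ⟨?_, (h u).isValid, fun θ => ?_⟩
  · have : IsProbabilityMeasure ((Measure.pi fun _ : Fin n => ρ).map fun x => ∑ i, x i) :=
      Measure.isProbabilityMeasure_map hm.aemeasurable
    exact Measure.isProbabilityMeasure_map hr.aemeasurable
  · change charFunPi _ θ = _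
    have hp := (hρ u).isProbabilityMeasure
    rw [hmap, charFunPi_map_sum_pi]
    have h1 : charFunPi (ρ.map u.restrict) θ = _ := (hρ u).charFun_eq θ
    rw [h1, ← Complex.exp_nat_mul, exponent_fieldTriplet_smul u hc, ← mul_assoc,
      Complex.ofReal_inv, Complex.ofReal_natCast, mul_inv_cancel₀ (by exact_mod_cast hn'), one_mul]

end FieldTriplet

/-! ### Master Lévy measures -/

section Master

variable {U : Type*} {T : (u : Finset U) → CharTriplet u}

theorem measurableSet_forall_eq_zero {U₀ : Set U} (h : U₀.Countable) :
    MeasurableSet {x : U → ℝ | ∀ u ∈ U₀, x u = 0} := by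
  have : {x : U → ℝ | ∀ u ∈ U₀, x u = 0} = ⋂ u ∈ U₀, {x | x u = 0} := by ext; simp
  rw [this]
  exact .biInter h fun u _ => measurableSet_eq_fun (measurable_pi_apply u) measurable_const

/-- The functions `1 ∧ x_u²` for `u` in the countable set `U₀` have finite integrals and vanish
together only on a null set. Fubini with Lebesgue measure depends on this. -/
theorem IsMaster.sigmaFinite {ν : Measure (U → ℝ)} (h : IsMaster ν T) : SigmaFinite ν := by
  obtain ⟨U₀, hU₀, hnull⟩ := h.doesNotChargeZero
  have := hU₀.to_subtype
  refine sigmaFinite_of_lintegral_ne_top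
    (fun (u : U₀) (x : U → ℝ) => ENNReal.ofReal (min 1 (x u ^ 2)))
    (fun u => by fun_prop) (fun u => h.cap_lt_top u) (measure_mono_null ?_ hnull)
  intro x hx u hu
  have h1 := ENNReal.ofReal_eq_zero.1 (hx ⟨u, hu⟩)
  by_contra hne
  have : 0 < x u ^ 2 := lt_of_le_of_ne (sq_nonneg _) (Ne.symm (pow_ne_zero 2 hne))
  exact absurd (lt_min one_pos this) (not_lt.2 h1)

/-- Adding `v` to the base turns the intersection into a cylinder whose base misses the origin,
where the triplets prescribe both measures. -/
theorem IsPseudoMaster.measure_cylinder_inter_eq {ν ν' : Measure (U → ℝ)}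
    (h : IsPseudoMaster ν T) (h' : IsPseudoMaster ν' T) (v : U) {c : ℝ} (hc : 0 < c)
    {A : Set (U → ℝ)} (hA : A ∈ measurableCylinders fun _ : U => ℝ) :
    ν (A ∩ {x | c ≤ x v ^ 2}) = ν' (A ∩ {x | c ≤ x v ^ 2}) := by
  classical
  obtain ⟨I, S, hS, rfl⟩ := (mem_measurableCylinders A).1 hA
  have hsub : I ⊆ insert v I := Finset.subset_insert v I
  let C : Set (↥(insert v I) → ℝ) :=
    Finset.restrict₂ (π := fun _ => ℝ) hsub ⁻¹' S ∩
      {y : ↥(insert v I) → ℝ | c ≤ y ⟨v, Finset.mem_insert_self v I⟩ ^ 2}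
  have hC : MeasurableSet C := (Finset.measurable_restrict₂ hsub hS).inter
    (measurableSet_le measurable_const (by fun_prop))
  have h0 : (0 : ↥(insert v I) → ℝ) ∉ C := by
    rintro ⟨-, h⟩
    simp only [Set.mem_ofPred_eq, Pi.zero_apply] at h
    linarith [show (0 : ℝ) ^ 2 = 0 by norm_num]
  have heq : cylinder I S ∩ {x : U → ℝ | c ≤ x v ^ 2}
      = Finset.restrict (π := fun _ : U => ℝ) (insert v I) ⁻¹' C := rfl
  rw [heq, ← h.levy_eq _ C hC h0, ← h'.levy_eq _ C hC h0]

/-- Master Lévy measures are unique. -/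
theorem IsMaster.eq {ν ν' : Measure (U → ℝ)} (h : IsMaster ν T) (h' : IsMaster ν' T) :
    ν = ν' := by
  obtain ⟨U₁, hU₁, hn₁⟩ := h.doesNotChargeZero
  obtain ⟨U₂, hU₂, hn₂⟩ := h'.doesNotChargeZero
  have := (hU₁.union hU₂).to_subtype
  -- Using both countable sets makes the complement of the union null for `ν` and `ν'` alike. Each
  -- piece has finite measure, so agreement on the π-system of cylinders suffices.
  let S : ↥(U₁ ∪ U₂) × ℕ → Set (U → ℝ) := fun p => {x | 1 / ((p.2 : ℝ) + 1) ≤ x p.1 ^ 2}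
  have hSm : ∀ p, MeasurableSet (S p) := fun p =>
    measurableSet_le measurable_const (by fun_prop)
  have hcompl : ∀ x, x ∉ ⋃ p, S p → ∀ u ∈ U₁ ∪ U₂, x u = 0 := by
    intro x hx u hu
    by_contra hne
    have : 0 < x u ^ 2 := lt_of_le_of_ne (sq_nonneg _) (Ne.symm (pow_ne_zero 2 hne))
    obtain ⟨n, hn⟩ := exists_nat_one_div_lt this
    exact hx (Set.mem_iUnion.2 ⟨(⟨u, hu⟩, n), hn.le⟩)
  have hr : ν.restrict (⋃ p, S p) = ν := by
    refine Measure.restrict_eq_self_of_ae_mem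
      (measure_mono_null (fun x hx u hu => hcompl x hx u (Or.inl hu)) hn₁)
  have hr' : ν'.restrict (⋃ p, S p) = ν' := by
    refine Measure.restrict_eq_self_of_ae_mem
      (measure_mono_null (fun x hx u hu => hcompl x hx u (Or.inr hu)) hn₂)
  rw [← hr, ← hr', Measure.restrict_iUnion_congr]
  rintro ⟨u, n⟩
  have hpos : (0 : ℝ) < 1 / ((n : ℝ) + 1) := by positivity
  have hle : 1 / ((n : ℝ) + 1) ≤ 1 := by
    rw [div_le_one (by positivity)]; linarith [n.cast_nonneg (α := ℝ)]
  have heq : ∀ A ∈ measurableCylinders fun _ : U => ℝ,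
      ν.restrict (S (u, n)) A = ν'.restrict (S (u, n)) A := by
    intro A hA
    have hAm : MeasurableSet A := MeasurableSet.of_mem_measurableCylinders hA
    rw [Measure.restrict_apply hAm, Measure.restrict_apply hAm]
    exact h.toIsPseudoMaster.measure_cylinder_inter_eq h'.toIsPseudoMaster u hpos hA
  have hfin : IsFiniteMeasure (ν.restrict (S (u, n))) := by
    constructor
    rw [Measure.restrict_apply_univ]
    have hsub : S (u, n) ⊆ {x : U → ℝ |
        ENNReal.ofReal (1 / ((n : ℝ) + 1)) ≤ ENNReal.ofReal (min 1 (x u ^ 2))} := fun x hx =>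
      ENNReal.ofReal_le_ofReal (le_min hle hx)
    refine (measure_mono hsub).trans_lt
      ((meas_ge_le_lintegral_div
        (f := fun x : U → ℝ => ENNReal.ofReal (min 1 (x u ^ 2)))
        (Measurable.aemeasurable (by fun_prop)) ?_ ENNReal.ofReal_ne_top).trans_lt
        (ENNReal.div_lt_top (h.cap_lt_top u).ne ?_))
    · simpa using hpos
    · simpa using hpos
  exact ext_of_generate_finite _ generateFrom_measurableCylinders.symm
    isPiSystem_measurableCylinders heq
    (heq _ ((mem_measurableCylinders _).2 ⟨∅, Set.univ, .univ, rfl⟩))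

end Master

/-! ### The integrated field -/

section IntegratedField

variable {U : Type*} {Γ : U → ℝ} {B : U → U → ℝ} {ν : Measure (U → ℝ)} {f : ℝ → ℝ}

theorem measurableSet_setOf_ne_zero (hf : Measurable f) : MeasurableSet {s | f s ≠ 0} :=
  hf (measurableSet_singleton 0).compl

/-- Where `f` vanishes, every point is sent to the origin, which `A` avoids. -/
theorem scaledImage_support_apply (hf : Measurable f) [SFinite ν] {A : Set (U → ℝ)}
    (hA : MeasurableSet A) (h0 : (0 : U → ℝ) ∉ A) :
    scaledImage f {s | f s ≠ 0} ν A = scaledImage f Set.univ ν A := by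
  rw [scaledImage_apply hf _ _ hA, scaledImage_apply hf _ _ hA, Measure.restrict_univ,
    ← lintegral_indicator (measurableSet_setOf_ne_zero hf)]
  refine lintegral_congr fun s => ?_
  by_cases hs : f s = 0
  · rw [Set.indicator_of_notMem (by simp [hs])]
    simp [hs, h0]
  · exact Set.indicator_of_mem hs _

theorem integralTriplet_levy_apply (hf : Measurable f) [SFinite ν] {u : Finset U}
    (h : (fieldTriplet Γ B ν u).IsValid) {A : Set (u → ℝ)}
    (hA : MeasurableSet A) (h0 : (0 : u → ℝ) ∉ A) :
    (integralTriplet f (fieldTriplet Γ B ν u)).levy A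
      = scaledImage f Set.univ ν (u.restrict ⁻¹' A) := by
  have := h.isLevyMeasure.sigmaFinite
  have hA' : A ∩ {0}ᶜ = A := by
    rw [Set.inter_eq_left]
    exact fun x hx h => h0 (h ▸ hx)
  rw [integralTriplet, Measure.restrict_apply hA, hA', scaledImage_apply hf _ _ hA,
    scaledImage_apply hf _ _ (Finset.measurable_restrict u hA)]
  refine lintegral_congr fun s => ?_
  exact fieldTriplet_levy_apply Γ B ν u (measurable_const_smul (f s) hA) (by simpa using h0)

theorem zero_notMem_restrict_preimage {u : Finset U} {A : Set (u → ℝ)} (h0 : (0 : u → ℝ) ∉ A) :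
    (0 : U → ℝ) ∉ u.restrict ⁻¹' A := h0

/-- The drift function of the integrated field. -/
noncomputable def integralDrift (f : ℝ → ℝ) (Γ : U → ℝ) (ν : Measure (U → ℝ)) (v : U) : ℝ :=
  ∫ s, (f s * Γ v + ∫ x, (trunc (f s * x v) - f s * trunc (x v)) ∂ν)

/-- The covariance function of the integrated field. -/
noncomputable def integralCov (f : ℝ → ℝ) (B : U → U → ℝ) (v w : U) : ℝ :=
  ∫ s, f s ^ 2 * B v w

/-- Because truncation acts coordinatewise, the result depends on `i` but not on the surrounding set
`u`. Hence the integrated drifts are restrictions of one function on `U`. -/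
theorem scaledDrift_fieldTriplet_apply {u : Finset U} (h : (fieldTriplet Γ B ν u).IsValid)
    (r : ℝ) (i : u) :
    (fieldTriplet Γ B ν u).scaledDrift r i
      = r * Γ i + ∫ x, (trunc (r * x i) - r * trunc (x i)) ∂ν := by
  have h1 := ContinuousLinearMap.integral_comp_comm
    (ContinuousLinearMap.proj (R := ℝ) (φ := fun _ : u => ℝ) i)
    (h.isLevyMeasure.integrable_truncVec_smul_sub r)
  have hm : Measurable fun x : u → ℝ => trunc (r * x i) - r * trunc (x i) :=
    (measurable_trunc.comp (by fun_prop)).sub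
      ((measurable_trunc.comp (measurable_pi_apply i)).const_mul r)
  have h2 := integral_fieldTriplet_levy Γ B ν u hm.stronglyMeasurable (by simp [trunc_zero])
  rw [CharTriplet.scaledDrift, Pi.add_apply]
  congr 1
  exact h1.symm.trans h2

theorem integralTriplet_drift {u : Finset U} (h : (fieldTriplet Γ B ν u).IsValid)
    (hf : (fieldTriplet Γ B ν u).IntegrableFor f) :
    (integralTriplet f (fieldTriplet Γ B ν u)).drift = u.restrict (integralDrift f Γ ν) := by
  ext i
  have h1 := ContinuousLinearMap.integral_comp_comm
    (ContinuousLinearMap.proj (R := ℝ) (φ := fun _ : u => ℝ) i) hf.drift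
  refine h1.symm.trans (integral_congr_ae (ae_of_all _ fun s => ?_))
  exact scaledDrift_fieldTriplet_apply h (f s) i

theorem integralTriplet_cov (u : Finset U) :
    (integralTriplet f (fieldTriplet Γ B ν u)).cov
      = Matrix.of fun i j : u => integralCov f B i j := rfl

theorem fieldTriplet_scaledImage_eq [SFinite ν] {u : Finset U}
    (h : (fieldTriplet Γ B ν u).IsValid) (hf : (fieldTriplet Γ B ν u).IntegrableFor f) :
    fieldTriplet (integralDrift f Γ ν) (integralCov f B) (scaledImage f {s | f s ≠ 0} ν) u
      = integralTriplet f (fieldTriplet Γ B ν u) := by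
  have hlevy : (fieldTriplet (integralDrift f Γ ν) (integralCov f B)
      (scaledImage f {s | f s ≠ 0} ν) u).levy
      = (integralTriplet f (fieldTriplet Γ B ν u)).levy := by
    ext A hA
    have hAm : MeasurableSet (A ∩ {0}ᶜ) := hA.inter (measurableSet_singleton 0).compl
    have h0 : (0 : u → ℝ) ∉ A ∩ {0}ᶜ := fun h => h.2 rfl
    -- Neither Lévy measure charges the origin, so sets avoiding it are enough.
    have hres : ∀ m : Measure (u → ℝ), m.restrict {0}ᶜ A = m.restrict {0}ᶜ (A ∩ {0}ᶜ) := by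
      intro m
      rw [Measure.restrict_apply hA, Measure.restrict_apply hAm, Set.inter_assoc, Set.inter_self]
    refine (hres _).trans (Eq.trans ?_ (hres _).symm)
    exact (fieldTriplet_levy_apply (integralDrift f Γ ν) (integralCov f B) _ u hAm h0).trans
      ((scaledImage_support_apply hf.measurable (Finset.measurable_restrict u hAm)
        (zero_notMem_restrict_preimage h0)).trans
        (integralTriplet_levy_apply hf.measurable h hAm h0).symm)
  have hdrift := integralTriplet_drift h hf
  calc _ = CharTriplet.mk (u.restrict (integralDrift f Γ ν))
        (Matrix.of fun i j : u => integralCov f B i j)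
        (integralTriplet f (fieldTriplet Γ B ν u)).levy := by rw [← hlevy]; rfl
    _ = _ := by rw [← hdrift]; rfl

theorem isConsistent_integralTriplet [SFinite ν] (h : ∀ u, (fieldTriplet Γ B ν u).IsValid)
    (hf : ∀ u, (fieldTriplet Γ B ν u).IntegrableFor f) :
    IsConsistent fun u : Finset U => integralTriplet f (fieldTriplet Γ B ν u) := by
  classical
  refine ⟨fun u => integralTriplet_isValid (h u) (hf u), ?_, ?_, ?_⟩
  · refine ⟨integralDrift f Γ ν, fun u => integralTriplet_drift (h u) (hf u), fun Γ' hΓ' => ?_⟩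
    ext v
    -- Singletons determine the drift function; below, sets `{v, w}` determine the covariance.
    have h1 := (hΓ' {v}).symm.trans (integralTriplet_drift (h {v}) (hf {v}))
    exact congrFun h1 ⟨v, Finset.mem_singleton_self v⟩
  · refine ⟨integralCov f B, integralTriplet_cov, fun B' hB' => ?_⟩
    ext v w
    have h1 := (hB' {v, w}).symm.trans (integralTriplet_cov {v, w})
    exact congrFun (congrFun h1 ⟨v, by simp⟩) ⟨w, by simp⟩
  · intro u v huv A hA h0
    have hm := (hf u).measurable
    rw [integralTriplet_levy_apply hm (h u) hA h0, integralTriplet_levy_apply hm (h v)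
      (Finset.measurable_restrict₂ huv hA) h0]
    rfl

theorem lintegral_cap_scaledImage_lt_top [SFinite ν] {v : U}
    (hf : (fieldTriplet Γ B ν {v}).IntegrableFor f) (S : Set ℝ) :
    ∫⁻ x, ENNReal.ofReal (min 1 (x v ^ 2)) ∂scaledImage f S ν < ∞ := by
  rw [lintegral_scaledImage hf.measurable S ν (by fun_prop)]
  refine ((setLIntegral_le_lintegral S _).trans_eq (lintegral_congr fun s => ?_)).trans_lt hf.levy
  rw [lintegral_fieldTriplet_levy Γ B ν {v} (g := fun x => capSq (f s • x))
    (measurable_capSq.comp (measurable_const_smul (f s))) (by simp [capSq])]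
  refine lintegral_congr fun x => ?_
  have : ∑ i : ({v} : Finset U), (f s • Finset.restrict ({v} : Finset U) x) i ^ 2
      = (f s • x) v ^ 2 := by
    rw [Finset.univ_unique, Finset.sum_singleton]
    rfl
  rw [capSq, this]

theorem isPseudoMaster_scaledImage [SFinite ν] (h : ∀ u, (fieldTriplet Γ B ν u).IsValid)
    (hf : ∀ u, (fieldTriplet Γ B ν u).IntegrableFor f) :
    IsPseudoMaster (scaledImage f Set.univ ν)
      fun u : Finset U => integralTriplet f (fieldTriplet Γ B ν u) :=
  ⟨fun u _ hA h0 => integralTriplet_levy_apply (hf u).measurable (h u) hA h0,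
    fun v => lintegral_cap_scaledImage_lt_top (hf {v}) _⟩

/-- Multiplication by a nonzero `f s` preserves the vanishing of coordinates, so the same countable
set `U₀` works. -/
theorem doesNotChargeZero_scaledImage [SFinite ν] (hf : Measurable f)
    (h : DoesNotChargeZero ν) : DoesNotChargeZero (scaledImage f {s | f s ≠ 0} ν) := by
  obtain ⟨U₀, hU₀, hnull⟩ := h
  refine ⟨U₀, hU₀, ?_⟩
  rw [scaledImage_apply hf _ _ (measurableSet_forall_eq_zero hU₀),
    setLIntegral_congr_fun (g := fun _ => 0) (measurableSet_setOf_ne_zero hf) fun s hs => ?_,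
    lintegral_zero]
  refine measure_mono_null (t := {x | ∀ u ∈ U₀, x u = 0}) (fun x hx u hu => ?_) hnull
  exact (mul_eq_zero.1 (hx u hu)).resolve_left hs

theorem isMaster_scaledImage [SFinite ν] (h : ∀ u, (fieldTriplet Γ B ν u).IsValid)
    (hf : ∀ u, (fieldTriplet Γ B ν u).IntegrableFor f) (hν : DoesNotChargeZero ν) :
    IsMaster (scaledImage f {s | f s ≠ 0} ν)
      fun u : Finset U => integralTriplet f (fieldTriplet Γ B ν u) where
  levy_eq u A hA h0 := by
    rw [integralTriplet_levy_apply (hf u).measurable (h u) hA h0,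
      scaledImage_support_apply (hf u).measurable (Finset.measurable_restrict u hA)
        (zero_notMem_restrict_preimage h0)]
  cap_lt_top v := lintegral_cap_scaledImage_lt_top (hf {v}) _
  doesNotChargeZero := doesNotChargeZero_scaledImage (hf ∅).measurable hν

theorem scaledImage_eq_lintegral_indicator [SFinite ν] (hf : Measurable f) (S : Set ℝ)
    {A : Set (U → ℝ)} (hA : MeasurableSet A) :
    scaledImage f S ν A = ∫⁻ s in S, ∫⁻ x, A.indicator 1 (f s • x) ∂ν := by
  rw [← lintegral_scaledImage hf S ν (measurable_one.indicator hA), lintegral_indicator_one hA]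

end IntegratedField

/-! ### Assembly of the main theorem. -/

theorem mainTheorem11 {U Ω : Type*} [MeasurableSpace Ω] (P : Measure Ω) [IsProbabilityMeasure P]
    (X : U → Ω → ℝ) (hX : ∀ u, Measurable (X u))
    (Γ : U → ℝ) (B : U → U → ℝ) (ν : Measure (U → ℝ))
    (hν : HasFieldTriplet (P.map (fun ω u => X u ω)) Γ B ν)
    (f : ℝ → ℝ) (hf : ∀ u : Finset U, (fieldTriplet Γ B ν u).IntegrableFor f) :
    -- the integrals `∫ f dL_u` have the triplets `integralTriplet f (fieldTriplet Γ B ν u)`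
    (∀ (u : Finset U) (Ω' : Type*) [MeasurableSpace Ω'] (P' : Measure Ω') [IsProbabilityMeasure P']
        (L : ℝ → Ω' → u → ℝ) (Z : Ω' → u → ℝ), IsTwoSidedLevy P' L →
        P'.map (L 1) = P.map (fun ω (i : u) => X i ω) →
        IsLevyIntegral P' L (fieldTriplet Γ B ν u) f Z →
        HasTriplet (P'.map Z) (integralTriplet f (fieldTriplet Γ B ν u))) ∧
    -- the system of these triplets is consistent
    IsConsistent (fun u : Finset U => integralTriplet f (fieldTriplet Γ B ν u)) ∧
    -- it lifts to an infinitely divisible field, unique in law, with its master Lévy measure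
    (∃ (Γ' : U → ℝ) (B' : U → U → ℝ) (μ : Measure (U → ℝ)),
      (∀ u : Finset U, fieldTriplet Γ' B' (scaledImage f {s | f s ≠ 0} ν) u =
        integralTriplet f (fieldTriplet Γ B ν u)) ∧
      HasFieldTriplet μ Γ' B' (scaledImage f {s | f s ≠ 0} ν) ∧
      ∀ μ' : Measure (U → ℝ), (∀ u : Finset U, HasTriplet (μ'.map u.restrict)
        (integralTriplet f (fieldTriplet Γ B ν u))) → μ' = μ) ∧
    -- the master Lévy measure is unique
    (∀ ν' : Measure (U → ℝ),
      IsMaster ν' (fun u : Finset U => integralTriplet f (fieldTriplet Γ B ν u)) →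
      ν' = scaledImage f {s | f s ≠ 0} ν) ∧
    -- the measure `∫∫ 1_A(f(s) x) ν(dx) ds` is a pseudo master Lévy measure, and it is the master
    -- Lévy measure when `f` is almost everywhere non-zero
    IsPseudoMaster (scaledImage f Set.univ ν)
      (fun u : Finset U => integralTriplet f (fieldTriplet Γ B ν u)) ∧
    ((∀ᵐ s, f s ≠ 0) → IsMaster (scaledImage f Set.univ ν)
      (fun u : Finset U => integralTriplet f (fieldTriplet Γ B ν u))) ∧
    -- the explicit form of these two measures
    (∀ A : Set (U → ℝ), MeasurableSet A →
      scaledImage f {s | f s ≠ 0} ν A =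
        ∫⁻ s in {s | f s ≠ 0}, ∫⁻ x, A.indicator 1 (f s • x) ∂ν ∧
      scaledImage f Set.univ ν A = ∫⁻ s, ∫⁻ x, A.indicator 1 (f s • x) ∂ν) := by

  have hvalid : ∀ u, (fieldTriplet Γ B ν u).IsValid := fun u => (hν.hasTriplet u).isValid
  have hσ : SigmaFinite ν := hν.isMaster.sigmaFinite
  have hfm : Measurable f := (hf ∅).measurable
  have hmaster := isMaster_scaledImage hvalid hf hν.isMaster.doesNotChargeZero
  have heq : ∀ u : Finset U,
      fieldTriplet (integralDrift f Γ ν) (integralCov f B) (scaledImage f {s | f s ≠ 0} ν) u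
        = integralTriplet f (fieldTriplet Γ B ν u) := fun u =>
    fieldTriplet_scaledImage_eq (hvalid u) (hf u)
  refine ⟨?_, isConsistent_integralTriplet hvalid hf, ?_, fun ν' hν' => hν'.eq hmaster,
    isPseudoMaster_scaledImage hvalid hf, fun hne => ?_, fun A hA => ⟨?_, ?_⟩⟩
  · intro u Ω' _ P' _ L Z hL hL1 hZ
    refine hZ.hasTriplet hL ?_ (hf u)
    have := hν.hasTriplet u
    rw [Measure.map_map (Finset.measurable_restrict u) (measurable_pi_lambda _ hX)] at this
    rw [hL1]
    exact this
  · obtain ⟨μ, hμ⟩ := exists_hasTriplet_map_restrict (Γ := integralDrift f Γ ν)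
      (B := integralCov f B) (ν := scaledImage f {s | f s ≠ 0} ν) fun u => by
        rw [heq u]; exact integralTriplet_isValid (hvalid u) (hf u)
    refine ⟨integralDrift f Γ ν, integralCov f B, μ, heq,
      ⟨isProbabilityMeasure_of_hasTriplet hμ, isInfDivLaw_of_hasTriplet hμ, hμ, ?_⟩,
      fun μ' hμ' => eq_of_hasTriplet_map_restrict (fun u => heq u ▸ hμ u) hμ'⟩
    rw [show fieldTriplet (integralDrift f Γ ν) (integralCov f B)
      (scaledImage f {s | f s ≠ 0} ν) = _ from funext heq]
    exact hmaster
  · have : scaledImage f Set.univ ν = scaledImage f {s | f s ≠ 0} ν := by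
      rw [scaledImage, scaledImage, Measure.restrict_univ,
        Measure.restrict_eq_self_of_ae_mem (s := {s | f s ≠ 0}) hne]
    rw [this]
    exact hmaster
  · exact scaledImage_eq_lintegral_indicator hfm _ hA
  · rw [scaledImage_eq_lintegral_indicator hfm _ hA, Measure.restrict_univ]
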